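/- Take tiles that are congruent copies of a rhombus of side $1$ with angles of $60^\circ$ and $120^\circ$, placed in the Euclidean plane in arbitrary position and orientation. A tredoku tiling (without holes) is a finite set $\mathcal T$ of $\tau > 4$ such tiles with the following properties. (P1) $\mathcal T$ is edge-connected: the graph on the tiles in which two tiles are adjacent if they have a common side is connected. (P2) If two distinct tiles of $\mathcal T$ touch, then their intersection is either a single point that is a vertex of both, or a common side of both. (P3) After the removal of any one tile, the remaining tiles are still connected, where now two tiles count as connected if they touch (at a vertex or along a side). (P4) If tiles $A$ and $B$ of $\mathcal T$ share a side $p$, then there is a third tile $C$ of $\mathcal T$ that shares a side $q$ of $A$ or of $B$, where $q$ is parallel to $p$. (P5) There are no runs of more than three tiles, where a run is a sequence of distinct tiles of $\mathcal T$ in which consecutive tiles have a common side and all these common sides are parallel to one another. (P6) There are no holes: the complement in the plane of the union of the (closed) tiles is connected. The number $\rho$ of runs of $\mathcal T$ is the number of its runs of three tiles, a run and its reversal being counted as the same run. **Corollary.** There is no tredoku tiling with $\tau = 12$ tiles and $\rho = 8$ runs. -/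

import Mathlib

noncomputable section

namespace Tredoku

/-- The rotation of the plane `ℂ` through an angle of 60 degrees, as a complex number. -/
def omega : ℂ := Complex.exp ((Real.pi / 3 : ℝ) * Complex.I)

/-- A tile placed in the plane `ℂ`: a rhombus of side 1 with angles of 60 and 120 degrees, in
arbitrary position and orientation. It is recorded by one of its two acute vertices `base` and the
unit vector `dir` along the side that leaves `base` clockwise of the other one; the other side at
`base` is along `omega * dir`. (Each rhombus is recorded in two ways, one for each acute vertex;
the condition `touch` of `IsTredoku` ensures that at most one of them occurs in a tiling.) -/
structure Tile where
  base : ℂ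
  dir : ℂ
  norm_dir : ‖dir‖ = 1

namespace Tile

/-- The second side vector at the acute vertex `base`. -/
def dir' (t : Tile) : ℂ := omega * t.dir

/-- The four vertices of a tile. -/
def vertices (t : Tile) : Set ℂ :=
  {t.base, t.base + t.dir, t.base + t.dir + t.dir', t.base + t.dir'}

/-- The four sides of a tile, as closed segments. -/
def sides (t : Tile) : Set (Set ℂ) :=
  {segment ℝ t.base (t.base + t.dir),
   segment ℝ (t.base + t.dir) (t.base + t.dir + t.dir'),
   segment ℝ (t.base + t.dir') (t.base + t.dir + t.dir'),
   segment ℝ t.base (t.base + t.dir')}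

/-- The closed rhombus occupied by a tile. -/
def body (t : Tile) : Set ℂ := convexHull ℝ t.vertices

end Tile

/-- The dual graph of a finite family of tiles: two tiles are adjacent if they have a common side. -/
def dualGraph (𝒯 : Finset Tile) : SimpleGraph 𝒯 where
  Adj A B := A ≠ B ∧ ∃ p, p ∈ A.1.sides ∧ p ∈ B.1.sides
  symm := ⟨fun _ _ h => ⟨h.1.symm, h.2.imp fun _ hp => ⟨hp.2, hp.1⟩⟩⟩
  loopless := ⟨fun _ h => h.1 rfl⟩

/-- The neighbour dual graph: two tiles are joined if they touch (in at least one point). -/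
def neighbourGraph (𝒯 : Finset Tile) : SimpleGraph 𝒯 where
  Adj A B := A ≠ B ∧ (A.1.body ∩ B.1.body).Nonempty
  symm := ⟨fun _ _ h => ⟨h.1.symm, Set.inter_comm _ _ ▸ h.2⟩⟩
  loopless := ⟨fun _ h => h.1 rfl⟩

/-- Two segments are parallel (the affine lines that they span are parallel). -/
def ParallelSides (p q : Set ℂ) : Prop := (affineSpan ℝ p).Parallel (affineSpan ℝ q)

/-- `T 0, …, T k` is a run of `k + 1` tiles of `𝒯`: the tiles are distinct, consecutive tiles have
a side in common, and these common sides are all parallel to one another. -/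
def IsRun (𝒯 : Finset Tile) {k : ℕ} (T : Fin (k + 1) → Tile) : Prop :=
  Function.Injective T ∧ (∀ i, T i ∈ 𝒯) ∧
    ∃ p : Fin k → Set ℂ,
      (∀ i : Fin k, p i ∈ (T i.castSucc).sides ∧ p i ∈ (T i.succ).sides) ∧
      ∀ i j : Fin k, ParallelSides (p i) (p j)

/-- Tredoku tilings (without holes). -/
structure IsTredoku (𝒯 : Finset Tile) : Prop where
  /-- There are more than four tiles. -/
  four_lt_card : 4 < 𝒯.card
  /-- The tiling is connected through sides of tiles. -/
  connected : (dualGraph 𝒯).Connected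
  /-- If two tiles touch, then they do so only at a vertex or they have a side in common; in
  particular, distinct tiles do not overlap. -/
  touch : ∀ A ∈ 𝒯, ∀ B ∈ 𝒯, A ≠ B →
    A.body ∩ B.body = ∅ ∨
    (∃ v, v ∈ A.vertices ∧ v ∈ B.vertices ∧ A.body ∩ B.body = {v}) ∨
    (∃ p, p ∈ A.sides ∧ p ∈ B.sides ∧ A.body ∩ B.body = p)
  /-- The tiling cannot be disconnected by removing just one tile, where connection by just a
  vertex is allowed after the removal. -/
  connected_remove : ∀ X : 𝒯, ((neighbourGraph 𝒯).induce {X}ᶜ).Connected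
  /-- If two tiles share a side, then there is a third tile that shares a parallel side with one
  of them. -/
  exists_third : ∀ A ∈ 𝒯, ∀ B ∈ 𝒯, A ≠ B → ∀ p, p ∈ A.sides → p ∈ B.sides →
    ∃ C ∈ 𝒯, C ≠ A ∧ C ≠ B ∧
      ∃ q, q ∈ C.sides ∧ (q ∈ A.sides ∨ q ∈ B.sides) ∧ ParallelSides q p
  /-- There are no runs of more than three tiles. -/
  run_le_three : ∀ (k : ℕ) (T : Fin (k + 1) → Tile), IsRun 𝒯 T → k + 1 ≤ 3
  /-- There are no holes: the part of the plane that is not covered by the tiles is connected. -/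
  no_holes : IsConnected (⋃ t ∈ 𝒯, t.body)ᶜ

/-- The number of runs of three tiles; a run is counted once, as a set of tiles, irrespective of
the end from which it is read. -/
def numRuns (𝒯 : Finset Tile) : ℕ :=
  {R : Set Tile | ∃ T : Fin (2 + 1) → Tile, IsRun 𝒯 T ∧ Set.range T = R}.ncard

end Tredoku

end

/-! A tile has sides in two directions. By the bound on runs it lies in at most one run of three in
each of them, so the pairs (run, tile of the run) inject into the pairs (tile, direction of its
sides). With 8 runs and 12 tiles both sets have 24 elements: every tile lies in a run of exactly
three in both of its directions (`Placed.exists_chain`).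

Tiles with a common side lie on the same triangular lattice, so edge-connectedness puts the whole
tiling on one lattice (`IsTredoku.exists_placed`). There a tile is a lozenge, an up triangle joined
to an adjacent down triangle, and the touching rule forbids two tiles to share a triangle. What
remains is a combinatorial object, `Loz.Saturated`.

No such set `S` exists (`Loz.not_saturated`), by exhaustive search from a lozenge moved to the
origin. Given the lozenges of `S` found so far, choose one of them and a direction whose ribbon is
still unknown. That ribbon is one of twelve: three places for the chosen lozenge and two kinds for
each of the other two. A branch dies if the ribbon meets an excluded lozenge, if a known lozenge
would lengthen it, or if more than twelve lozenges would be needed. If every ribbon is known, the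
lozenges found are closed under adjacency and so are all of `S`, but there turn out to be fewer than
twelve. The kernel runs the search on bit sets; `Inv.attempt_false` and `Inv.step_false` show that
it misses no case. -/

namespace Tredoku

/-! ### Lozenges of the triangular lattice -/

/-- The directions of the sides of the triangular lattice. -/
inductive Dir
  | x | y | z
  deriving DecidableEq

namespace Dir

def num : Dir → ℕ
  | x => 0
  | y => 1
  | z => 2

/-- The two directions other than `d`. -/
def other : Dir → Bool → Dir
  | x, false => y
  | x, true => z
  | y, false => x
  | y, true => z
  | z, false => x
  | z, true => y

end Dir

/-- A lozenge of the triangular lattice: the union of the up triangle `t.1` and of the down triangle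
across its side of direction `t.2`. -/
abbrev Loz := (ℤ × ℤ) × Dir

namespace Loz

/-- The down triangle across the side of direction `d` of the up triangle `u`. -/
def dn (u : ℤ × ℤ) : Dir → ℤ × ℤ
  | .x => (u.1, u.2 - 1)
  | .y => (u.1 - 1, u.2)
  | .z => u

/-- The up triangle across the side of direction `d` of the down triangle `v`. -/
def up (v : ℤ × ℤ) : Dir → ℤ × ℤ
  | .x => (v.1, v.2 + 1)
  | .y => (v.1 + 1, v.2)
  | .z => v

/-- The two lozenges across the side of direction `d` of the up triangle of `t`. -/
def next (t : Loz) (d : Dir) (h : Bool) : Loz := (up (dn t.1 d) (d.other h), d.other h)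

/-- The two lozenges across the side of direction `d` of the down triangle of `t`. -/
def prev (t : Loz) (d : Dir) (h : Bool) : Loz := (up (dn t.1 t.2) d, d.other h)

/-- The other lozenges that contain one of the triangles of `t`. -/
def overlaps (t : Loz) : List Loz :=
  [(t.1, t.2.other false), (t.1, t.2.other true),
    (up (dn t.1 t.2) (t.2.other false), t.2.other false),
    (up (dn t.1 t.2) (t.2.other true), t.2.other true)]

/-- The lozenges that would lengthen a ribbon across `d` from `a` to `c`. -/
def ends (d : Dir) (a c : Loz) : List Loz :=
  [a.prev d false, a.prev d true, c.next d false, c.next d true]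

/-- The position of a lozenge in a bit set; the next bit belongs to the same lozenge. -/
def idx (t : Loz) : ℕ := 6 * (176 + t.1.1 + 32 * t.1.2).toNat + 2 * t.2.num

/-- The bit of a lozenge that stands for its sides of direction `d`. -/
def slot (d : Dir) (t : Loz) : ℕ :=
  match t.2, d with
  -- The two directions of the sides get the two bits in the order of `Dir.other`; for `d = t.2`,
  -- which is no side direction, the value is junk.
  | .x, .z | .y, .z | .z, .y => t.idx + 1
  | _, _ => t.idx

def mask : List Loz → ℕ
  | [] => 0
  | t :: l => 3 <<< t.idx ||| mask l

end Loz

/-! ### The exhaustive search -/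

namespace Search

open Loz

/-- `f x`, in a form that makes the kernel evaluate `x` first. -/
def force (x : ℕ) (f : ℕ → Bool) : Bool :=
  match x with
  | 0 => f 0
  | n + 1 => f n.succ

def both (p : Bool → Bool) : Bool := p false && p true

inductive Place
  | first | middle | last

/-- A ribbon of three lozenges that contains a given one and crosses its sides of a given
direction, described by the place of the given lozenge and the types of the other two. -/
structure Shape where
  kind : Dir
  side : Bool
  place : Place
  fst : Bool
  snd : Bool

namespace Shape

def dir (s : Shape) : Dir := s.kind.other s.side

def chain (s : Shape) (u : ℤ × ℤ) : Loz × Loz × Loz :=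
  match s.place with
  | .first => ((u, s.kind), next (u, s.kind) s.dir s.fst,
      (next (u, s.kind) s.dir s.fst).next s.dir s.snd)
  | .middle => (prev (u, s.kind) s.dir s.snd, (u, s.kind), next (u, s.kind) s.dir s.fst)
  | .last => ((prev (u, s.kind) s.dir s.fst).prev s.dir s.snd, prev (u, s.kind) s.dir s.fst,
      (u, s.kind))

/-- The masks of a shape are computed at the origin only; translation by `u` shifts them by `6 *
(u.1 + 32 * u.2)` bits. -/
def body (s : Shape) : ℕ := mask [(s.chain 0).1, (s.chain 0).2.1, (s.chain 0).2.2]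

def exterior (s : Shape) : ℕ := mask (ends s.dir (s.chain 0).1 (s.chain 0).2.2)

/-- The ribbon's own lozenges are left out, since ribbons of the other directions have to pass
through them. -/
def excluded (s : Shape) : ℕ :=
  mask ((s.chain 0).1.overlaps ++ ((s.chain 0).2.1.overlaps ++ ((s.chain 0).2.2.overlaps ++
    ends s.dir (s.chain 0).1 (s.chain 0).2.2)))

def slots (s : Shape) : ℕ :=
  1 <<< slot s.dir (s.chain 0).1 ||| (1 <<< slot s.dir (s.chain 0).2.1 |||
    1 <<< slot s.dir (s.chain 0).2.2)

def idx₁ (s : Shape) : ℕ := (s.chain 0).1.idx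
def idx₂ (s : Shape) : ℕ := (s.chain 0).2.1.idx
def idx₃ (s : Shape) : ℕ := (s.chain 0).2.2.idx

end Shape

def disj (m n : ℕ) : Bool := Nat.beq (Nat.land m n) 0

def bit (m i : ℕ) : ℕ := Nat.land 1 (Nat.shiftRight m i)

/-- Replace the lowest 64 bits, which are not used, by bits that depend on all the others: the
kernel hashes a numeral by its lowest 64 bits. -/
def mix (x : ℕ) : ℕ :=
  Nat.lor (Nat.shiftLeft (Nat.shiftRight x 64) 64) (Nat.mod (Nat.shiftRight x 64) (2 ^ 64 - 59))

/-- The value `true` means that this branch is refuted. The number `r` counts the lozenges still to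
be found; those of the ribbon that are already in `m` cost nothing, so they are credited to `r`
before 3 is subtracted. `K` is the rest of the search. -/
def attempt (K : ℕ → ℕ → ℕ → ℕ → Bool) (r m f g n : ℕ) (s : Shape) : Bool :=
  bif disj f (Nat.shiftLeft s.body n) then
    bif disj m (Nat.shiftLeft s.exterior n) then
      force (Nat.add r (Nat.add (bit m (Nat.add s.idx₁ n)) (Nat.add (bit m (Nat.add s.idx₂ n))
        (bit m (Nat.add s.idx₃ n))))) fun r =>
          bif Nat.ble 3 r then
            force (Nat.sub r 3) fun r =>
            force (mix (Nat.lor m (Nat.shiftLeft s.body n))) fun m =>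
            force (mix (Nat.lor f (Nat.shiftLeft s.excluded n))) fun f =>
            force (mix (Nat.lor g (Nat.shiftLeft s.slots n))) fun g => K r m f g
          else true
    else true
  else true

/-- The position of the lowest bit that is set in `x`, if it is less than `2 ^ k`. -/
def low : ℕ → ℕ → ℕ
  | 0, _ => 0
  | k + 1, x =>
    bif Nat.beq (Nat.mod x (Nat.pow 2 (Nat.pow 2 k))) 0 then
      Nat.add (Nat.pow 2 k) (low k (Nat.shiftRight x (Nat.pow 2 k)))
    else low k x

def attemptAll (K : ℕ → ℕ → ℕ → ℕ → Bool) (r m f g n : ℕ) (k : Dir) (h : Bool) : Bool :=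
  both fun a => both fun b => attempt K r m f g n ⟨k, h, .first, a, b⟩ &&
    (attempt K r m f g n ⟨k, h, .middle, a, b⟩ && attempt K r m f g n ⟨k, h, .last, a, b⟩)

def kinds (p : Dir → Bool → Bool) : ℕ → Bool
  | 0 => p .x false
  | 1 => p .x true
  | 2 => p .y false
  | 3 => p .y true
  | 4 => p .z false
  | _ => p .z true

/-- Bit 1056 = 6 * 176 is the first bit of the origin. Bits of `g` belong to lozenges of `m`, so the
xor shows the sides not yet dealt with. If there are none, the set found is closed and must have
twelve elements, which `1 ≤ r` refutes. That `low` finds the lowest bit is never needed: any bit of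
`m` would serve, and this is tested. -/
def step (K : ℕ → ℕ → ℕ → ℕ → Bool) (r m f g : ℕ) : Bool :=
  bif Nat.beq (Nat.shiftRight (Nat.xor m g) 1056) 0 then Nat.ble 1 r else
    force (low 11 (Nat.shiftRight (Nat.xor m g) 1056)) fun j =>
      bif Nat.beq (bit m (Nat.add 1056 j)) 1 then
        force (Nat.sub j (Nat.mod j 6)) fun n => kinds (attemptAll K r m f g n) (Nat.mod j 6)
      else false

/-- Running out of fuel yields `false`, so the value `true` certifies that the fuel sufficed. -/
def search : ℕ → ℕ → ℕ → ℕ → ℕ → Bool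
  | 0 => fun _ _ _ _ => false
  | n + 1 => step (search n)

/-- The first lozenge minimizes `x + 32 * y`, so all bits below those of the origin are excluded. -/
def start (t : Loz) : Bool :=
  force (mask [t]) fun m => force (2 ^ 1056 - 1 ||| mask t.overlaps) fun f => search 12 11 m f 0

theorem start_x : start (0, .x) = true := by decide +kernel
theorem start_y : start (0, .y) = true := by decide +kernel
theorem start_z : start (0, .z) = true := by decide +kernel

end Search
end Tredoku

/-! ### Translations, ribbons and the bit encoding -/

namespace Tredoku

namespace Dir

theorem other_ne (d : Dir) (h : Bool) : d.other h ≠ d := by cases d <;> cases h <;> decide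

theorem exists_other {d k : Dir} (h : d ≠ k) : ∃ e, d = k.other e := by
  cases d <;> cases k <;> first
    | exact absurd rfl h
    | exact ⟨false, rfl⟩
    | exact ⟨true, rfl⟩

theorem num_le (d : Dir) : d.num ≤ 2 := by cases d <;> decide

theorem num_injective {d e : Dir} (h : d.num = e.num) : d = e := by
  cases d <;> cases e <;> first | rfl | exact absurd h (by decide)

end Dir

namespace Loz

/-- Translation of a lozenge. -/
def shift (u : ℤ × ℤ) (t : Loz) : Loz := (u + t.1, t.2)

theorem dn_add (u v : ℤ × ℤ) (d : Dir) : dn (u + v) d = u + dn v d := by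
  cases d <;> ext <;> simp [dn] <;> ring

theorem up_add (u v : ℤ × ℤ) (d : Dir) : up (u + v) d = u + up v d := by
  cases d <;> ext <;> simp [up] <;> ring

@[simp] theorem up_dn (u : ℤ × ℤ) (d : Dir) : up (dn u d) d = u := by
  cases d <;> ext <;> simp [dn, up]

@[simp] theorem dn_up (v : ℤ × ℤ) (d : Dir) : dn (up v d) d = v := by
  cases d <;> ext <;> simp [dn, up]

theorem next_shift (u : ℤ × ℤ) (t : Loz) (d : Dir) (h : Bool) :
    (shift u t).next d h = shift u (t.next d h) := by
  simp [next, shift, dn_add, up_add]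

theorem prev_shift (u : ℤ × ℤ) (t : Loz) (d : Dir) (h : Bool) :
    (shift u t).prev d h = shift u (t.prev d h) := by
  simp [prev, shift, dn_add, up_add]

theorem overlaps_shift (u : ℤ × ℤ) (t : Loz) :
    (shift u t).overlaps = t.overlaps.map (shift u) := by
  simp [overlaps, shift, dn_add, up_add]

theorem ends_shift (u : ℤ × ℤ) (d : Dir) (a c : Loz) :
    ends d (shift u a) (shift u c) = (ends d a c).map (shift u) := by
  simp [ends, next_shift, prev_shift]

theorem shift_injective (u : ℤ × ℤ) : Function.Injective (shift u) := by
  rintro ⟨v, k⟩ ⟨w, l⟩ h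
  simpa [shift] using h

/-- The lozenge `t` is within distance `n` of the origin in both coordinates. -/
def Near (n : ℤ) (t : Loz) : Prop := |t.1.1| ≤ n ∧ |t.1.2| ≤ n

theorem Near.next {n : ℤ} {t : Loz} (ht : Near n t) (d : Dir) (h : Bool) :
    Near (n + 1) (t.next d h) := by
  simp only [Near, abs_le] at ht ⊢
  cases d <;> cases h <;> simp only [Loz.next, dn, up, Dir.other] <;> omega

theorem Near.prev {n : ℤ} {t : Loz} (ht : Near n t) (d : Dir) (h : Bool) :
    Near (n + 1) (t.prev d h) := by
  obtain ⟨u, k⟩ := t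
  simp only [Near, abs_le] at ht ⊢
  cases k <;> cases d <;> simp only [Loz.prev, dn, up] <;> omega

theorem Near.of_mem_overlaps {n : ℤ} {t s : Loz} (ht : Near n t) (hs : s ∈ t.overlaps) :
    Near (n + 1) s := by
  obtain ⟨u, k⟩ := t
  simp only [Near, abs_le] at ht ⊢
  simp only [overlaps, List.mem_cons, List.not_mem_nil, or_false] at hs
  rcases hs with rfl | rfl | rfl | rfl <;> cases k <;> simp only [dn, up, Dir.other] <;> omega

theorem Near.of_mem_ends {n : ℤ} {d : Dir} {a c s : Loz} (ha : Near n a) (hc : Near n c)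
    (hs : s ∈ ends d a c) : Near (n + 1) s := by
  simp only [ends, List.mem_cons, List.not_mem_nil, or_false] at hs
  rcases hs with rfl | rfl | rfl | rfl
  exacts [ha.prev .., ha.prev .., hc.next .., hc.next ..]

theorem Near.mono {m n : ℤ} {t : Loz} (ht : Near m t) (h : m ≤ n) : Near n t :=
  ⟨ht.1.trans h, ht.2.trans h⟩

/-- `b` follows `a` in a ribbon that crosses sides of direction `d`. -/
def IsNext (d : Dir) (a b : Loz) : Prop := a.2 ≠ d ∧ b.2 ≠ d ∧ dn a.1 d = dn b.1 b.2

theorem IsNext.exists_next {d : Dir} {a b : Loz} (h : IsNext d a b) : ∃ e, b = a.next d e := by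
  obtain ⟨e, he⟩ := Dir.exists_other h.2.1
  exact ⟨e, Prod.ext (by simp [next, h.2.2, ← he]) he⟩

theorem IsNext.exists_prev {d : Dir} {a b : Loz} (h : IsNext d a b) : ∃ e, a = b.prev d e := by
  obtain ⟨e, he⟩ := Dir.exists_other h.1
  exact ⟨e, Prod.ext (by simp [prev, ← h.2.2]) he⟩

theorem isNext_next {d : Dir} {a : Loz} (ha : a.2 ≠ d) (e : Bool) : IsNext d a (a.next d e) :=
  ⟨ha, Dir.other_ne d e, by simp [next]⟩

theorem isNext_prev {d : Dir} {a : Loz} (ha : a.2 ≠ d) (e : Bool) : IsNext d (a.prev d e) a :=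
  ⟨Dir.other_ne d e, ha, by simp [prev]⟩

theorem IsNext.shift {d : Dir} {a b : Loz} (h : IsNext d a b) (u : ℤ × ℤ) :
    IsNext d (shift u a) (shift u b) := by
  simpa [IsNext, Loz.shift, dn_add] using h

/-- A linear order of the lozenges of a ribbon. -/
def height : Dir → Loz → ℤ
  | .x, t => -t.1.2
  | .y, t => -t.1.1
  | .z, t => t.1.1 + t.1.2

theorem IsNext.height_lt {d : Dir} {a b : Loz} (h : IsNext d a b) : height d a < height d b := by
  obtain ⟨e, rfl⟩ := h.exists_next
  cases d <;> cases e <;> simp only [height, next, Dir.other, dn, up] <;> omega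

/-- A set of twelve lozenges without overlaps, connected through sides, in which each lozenge lies
in ribbons of exactly three in both of its directions. -/
structure Saturated (S : Finset Loz) : Prop where
  eq_of_up : ∀ s ∈ S, ∀ t ∈ S, s.1 = t.1 → s = t
  eq_of_dn : ∀ s ∈ S, ∀ t ∈ S, dn s.1 s.2 = dn t.1 t.2 → s = t
  ribbon : ∀ t ∈ S, ∀ d ≠ t.2, ∃ a ∈ S, ∃ b ∈ S, ∃ c ∈ S, IsNext d a b ∧ IsNext d b c ∧
    (t = a ∨ t = b ∨ t = c) ∧ (∀ h, a.prev d h ∉ S) ∧ ∀ h, c.next d h ∉ S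
  connected : ∀ P ⊆ S, P.Nonempty → (∀ t ∈ P, ∀ d ≠ t.2, ∀ h,
    (t.next d h ∈ S → t.next d h ∈ P) ∧ (t.prev d h ∈ S → t.prev d h ∈ P)) → P = S
  card : S.card = 12
  bounded : ∀ s ∈ S, ∀ t ∈ S, |s.1.1 - t.1.1| ≤ 11

theorem idx_le_slot (d : Dir) (t : Loz) : slot d t = t.idx ∨ slot d t = t.idx + 1 := by
  obtain ⟨u, k⟩ := t
  cases k <;> cases d <;> simp [slot]

theorem slot_other (u : ℤ × ℤ) (k : Dir) (e : Bool) :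
    slot (k.other e) (u, k) = idx (u, k) + e.toNat := by
  cases k <;> cases e <;> rfl

/-- The lozenge lies in the region in which `idx` is injective. -/
def InRegion (t : Loz) : Prop := |t.1.1| ≤ 15 ∧ 0 ≤ 176 + t.1.1 + 32 * t.1.2

theorem InRegion.idx_eq {t : Loz} (h : InRegion t) :
    (t.idx : ℤ) = 6 * (176 + t.1.1 + 32 * t.1.2) + 2 * t.2.num := by
  simp [idx, Int.toNat_of_nonneg h.2]

/-- First coordinates differ by at most 30 < 32, so `x + 32 * y` determines the position; its six
bits are two for each of the three kinds. -/
theorem InRegion.idx_inj {s t : Loz} (hs : InRegion s) (ht : InRegion t) {i j : ℕ}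
    (hi : i ≤ 1) (hj : j ≤ 1) (h : s.idx + i = t.idx + j) : s = t ∧ i = j := by
  have e₁ := hs.idx_eq
  have e₂ := ht.idx_eq
  have n₁ := Dir.num_le s.2
  have n₂ := Dir.num_le t.2
  obtain ⟨hs₁, hs₂⟩ := hs
  obtain ⟨ht₁, ht₂⟩ := ht
  rw [abs_le] at hs₁ ht₁
  have e : (s.2.num : ℤ) = t.2.num := by omega
  refine ⟨Prod.ext (Prod.ext ?_ ?_) (Dir.num_injective (by exact_mod_cast e)), ?_⟩ <;> omega

theorem InRegion.idx_eq_or {s t : Loz} (hs : InRegion s) (ht : InRegion t) {j : ℕ}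
    (h₁ : j = s.idx ∨ j = s.idx + 1) (h₂ : j = t.idx ∨ j = t.idx + 1) : s = t := by
  rcases h₁ with h₁ | h₁ <;> rcases h₂ with h₂ | h₂
  exacts [(hs.idx_inj ht (i := 0) (j := 0) (by omega) (by omega) (by omega)).1,
    (hs.idx_inj ht (i := 0) (j := 1) (by omega) (by omega) (by omega)).1,
    (hs.idx_inj ht (i := 1) (j := 0) (by omega) (by omega) (by omega)).1,
    (hs.idx_inj ht (i := 1) (j := 1) (by omega) (by omega) (by omega)).1]

theorem InRegion.slot_inj {t : Loz} {d e : Dir} (hd : d ≠ t.2) (he : e ≠ t.2)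
    (h : slot d t = slot e t) : d = e := by
  obtain ⟨u, k⟩ := t
  obtain ⟨i, rfl⟩ := Dir.exists_other hd
  obtain ⟨j, rfl⟩ := Dir.exists_other he
  simp only [slot_other] at h
  cases i <;> cases j <;> first | rfl | simp at h

theorem Near.idx_shift {t : Loz} (ht : Near 4 t) {u : ℤ × ℤ} (hu : 0 ≤ u.1 + 32 * u.2) :
    (shift u t).idx = t.idx + 6 * (u.1 + 32 * u.2).toNat := by
  simp only [Near, abs_le] at ht
  simp only [idx, shift, Prod.fst_add, Prod.snd_add]
  omega

theorem Near.slot_shift {t : Loz} (ht : Near 4 t) {u : ℤ × ℤ} (hu : 0 ≤ u.1 + 32 * u.2) (d : Dir) :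
    slot d (shift u t) = slot d t + 6 * (u.1 + 32 * u.2).toNat := by
  have := ht.idx_shift hu
  obtain ⟨v, k⟩ := t
  have h : (shift u (v, k)).2 = k := rfl
  cases k <;> cases d <;> simp only [slot, h] <;> omega

theorem testBit_mask (l : List Loz) (j : ℕ) :
    (mask l).testBit j = true ↔ ∃ t ∈ l, j = t.idx ∨ j = t.idx + 1 := by
  induction l with
  | nil => simp [mask]
  | cons t l ih =>
    have : (3 <<< t.idx).testBit j = true ↔ j = t.idx ∨ j = t.idx + 1 := by
      rw [Nat.testBit_shiftLeft]
      constructor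
      · intro h
        simp only [Bool.and_eq_true, decide_eq_true_eq] at h
        obtain ⟨h₁, h₂⟩ := h
        obtain ⟨i, rfl⟩ := Nat.exists_eq_add_of_le h₁
        rw [Nat.add_sub_cancel_left] at h₂
        have : i < 2 := by
          by_contra hi
          have : 3 < 2 ^ i := lt_of_lt_of_le (by norm_num) (Nat.pow_le_pow_right (by norm_num) (not_lt.1 hi))
          simp [Nat.testBit_lt_two_pow this] at h₂
        omega
      · rintro (rfl | rfl)
        · simp
        · simp; decide
    rw [mask, Nat.testBit_or, Bool.or_eq_true, this, ih, List.exists_mem_cons_iff]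

end Loz

/-! ### Meaning of the bit operations -/

namespace Search

open Loz

@[simp] theorem force_eq (x : ℕ) (f : ℕ → Bool) : force x f = f x := by cases x <;> rfl

theorem disj_eq_true (m n : ℕ) :
    disj m n = true ↔ ∀ j, m.testBit j = true → n.testBit j = true → False := by
  have h : disj m n = true ↔ m &&& n = 0 :=
    ⟨Nat.eq_of_beq_eq_true, fun h => (congrArg (Nat.beq · 0) h : _)⟩
  rw [h]
  constructor
  · intro h j h₁ h₂
    have := congrArg (fun x => x.testBit j) h
    simp [h₁, h₂] at this
  · intro h
    apply Nat.eq_of_testBit_eq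
    intro j
    rw [Nat.testBit_and, Nat.zero_testBit]
    by_contra hc
    simp at hc
    exact h j hc.1 hc.2

theorem bit_eq (m i : ℕ) : bit m i = (m.testBit i).toNat := by
  change 1 &&& (m >>> i) = _
  rw [Nat.testBit, Nat.and_comm, Nat.and_one_is_mod]
  rcases Nat.mod_two_eq_zero_or_one (m >>> i) with h | h <;>
    simp [h]

theorem testBit_mix {x j : ℕ} (h : 64 ≤ j) : (mix x).testBit j = x.testBit j := by
  change ((x >>> 64) <<< 64 ||| (x >>> 64) % (2 ^ 64 - 59)).testBit j = _
  have h₁ : (x >>> 64) % (2 ^ 64 - 59) < 2 ^ j :=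
    lt_of_lt_of_le ((Nat.mod_lt _ (by norm_num)).trans (by norm_num))
      (Nat.pow_le_pow_right (by norm_num) h)
  rw [Nat.testBit_or, Nat.testBit_lt_two_pow h₁, Nat.testBit_shiftLeft, Nat.testBit_shiftRight]
  simp [h]

theorem Shape.chain_eq (s : Shape) (u : ℤ × ℤ) :
    s.chain u = (shift u (s.chain 0).1, shift u (s.chain 0).2.1, shift u (s.chain 0).2.2) := by
  have h : (u, s.kind) = shift u (0, s.kind) := by simp [shift]
  obtain ⟨k, e, p, a, b⟩ := s
  cases p <;> simp only [Shape.chain] at h ⊢ <;> simp only [h, next_shift, prev_shift]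

theorem Shape.near (s : Shape) :
    Near 2 (s.chain 0).1 ∧ Near 2 (s.chain 0).2.1 ∧ Near 2 (s.chain 0).2.2 := by
  have h : Near 0 (0, s.kind) := by simp [Near]
  obtain ⟨k, e, p, a, b⟩ := s
  cases p
  · exact ⟨h.mono (by norm_num), (h.next _ _).mono (by norm_num), (h.next _ _).next _ _⟩
  · exact ⟨(h.prev _ _).mono (by norm_num), h.mono (by norm_num), (h.next _ _).mono (by norm_num)⟩
  · exact ⟨(h.prev _ _).prev _ _, (h.prev _ _).mono (by norm_num), h.mono (by norm_num)⟩

theorem Shape.exists_chain {u : ℤ × ℤ} {k : Dir} {e : Bool} {a b c : Loz}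
    (h₁ : IsNext (k.other e) a b) (h₂ : IsNext (k.other e) b c)
    (ht : (u, k) = a ∨ (u, k) = b ∨ (u, k) = c) :
    ∃ p i j, (⟨k, e, p, i, j⟩ : Shape).chain u = (a, b, c) := by
  rcases ht with rfl | rfl | rfl
  · obtain ⟨i, rfl⟩ := h₁.exists_next
    obtain ⟨j, rfl⟩ := h₂.exists_next
    exact ⟨.first, i, j, rfl⟩
  · obtain ⟨i, rfl⟩ := h₂.exists_next
    obtain ⟨j, rfl⟩ := h₁.exists_prev
    exact ⟨.middle, i, j, rfl⟩
  · obtain ⟨i, rfl⟩ := h₂.exists_prev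
    obtain ⟨j, rfl⟩ := h₁.exists_prev
    exact ⟨.last, i, j, rfl⟩

theorem of_attemptAll {K : ℕ → ℕ → ℕ → ℕ → Bool} {r m f g n : ℕ} {k : Dir} {h : Bool}
    (H : attemptAll K r m f g n k h = true) (p : Place) (i j : Bool) :
    attempt K r m f g n ⟨k, h, p, i, j⟩ = true := by
  simp only [attemptAll, both, Bool.and_eq_true] at H
  cases p <;> cases i <;> cases j <;> tauto

theorem kinds_eq (p : Dir → Bool → Bool) (k : Dir) (e : Bool) :
    kinds p (2 * k.num + e.toNat) = p k e := by
  cases k <;> cases e <;> rfl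

end Search
end Tredoku

/-! ### Soundness of the search -/

namespace Tredoku

namespace Loz

theorem mem_insert_three {P : Finset Loz} {a b c t : Loz} :
    t ∈ insert a (insert b (insert c P)) ↔ t ∈ [a, b, c] ∨ t ∈ P := by
  simp [or_assoc]

/-- All neighbours of `t` across its sides of direction `d` that are in `S` are in `P`. -/
def Done (S P : Finset Loz) (d : Dir) (t : Loz) : Prop :=
  ∀ h, (t.next d h ∈ S → t.next d h ∈ P) ∧ (t.prev d h ∈ S → t.prev d h ∈ P)

theorem Done.mono {S P Q : Finset Loz} {d : Dir} {t : Loz} (h : Done S P d t) (hPQ : P ⊆ Q) :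
    Done S Q d t :=
  fun e => ⟨fun hs => hPQ ((h e).1 hs), fun hs => hPQ ((h e).2 hs)⟩

namespace Saturated

variable {S : Finset Loz} (hS : Saturated S)
include hS

theorem notMem_of_mem_overlaps {t s : Loz} (ht : t ∈ S) (hs : s ∈ t.overlaps) : s ∉ S := by
  intro hsS
  simp only [overlaps, List.mem_cons, List.not_mem_nil, or_false] at hs
  rcases hs with rfl | rfl | rfl | rfl
  · exact Dir.other_ne _ _ (congrArg Prod.snd (hS.eq_of_up _ hsS _ ht rfl))
  · exact Dir.other_ne _ _ (congrArg Prod.snd (hS.eq_of_up _ hsS _ ht rfl))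
  · exact Dir.other_ne _ _ (congrArg Prod.snd (hS.eq_of_dn _ hsS _ ht (by simp)))
  · exact Dir.other_ne _ _ (congrArg Prod.snd (hS.eq_of_dn _ hsS _ ht (by simp)))

theorem next_eq {d : Dir} {a b : Loz} (h : IsNext d a b) (hb : b ∈ S) {e : Bool}
    (he : a.next d e ∈ S) : a.next d e = b :=
  hS.eq_of_dn _ he _ hb (by rw [← (isNext_next h.1 e).2.2, h.2.2])

theorem prev_eq {d : Dir} {a b : Loz} (h : IsNext d a b) (ha : a ∈ S) {e : Bool}
    (he : b.prev d e ∈ S) : b.prev d e = a :=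
  hS.eq_of_up _ he _ ha (by simp [prev, ← h.2.2])

theorem inRegion (h0 : ∃ k, ((0, k) : Loz) ∈ S) (hmin : ∀ t ∈ S, 0 ≤ t.1.1 + 32 * t.1.2) {t : Loz}
    (ht : t ∈ S) : InRegion t := by
  obtain ⟨k, hk⟩ := h0
  have h₁ := hS.bounded t ht _ hk
  have h₂ := hmin t ht
  simp only [Prod.fst_zero, sub_zero] at h₁
  exact ⟨h₁.trans (by norm_num), by omega⟩

/-- The bound 15 of `InRegion` is 11, for lozenges of `S`, plus 4, for what a shape can reach. -/
theorem inRegion_shift (h0 : ∃ k, ((0, k) : Loz) ∈ S)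
    (hmin : ∀ t ∈ S, 0 ≤ t.1.1 + 32 * t.1.2) {t : Loz} (ht : t ∈ S) {s : Loz} (hs : Near 4 s) :
    InRegion (shift t.1 s) := by
  obtain ⟨k, hk⟩ := h0
  have h₁ := hS.bounded t ht _ hk
  have h₂ := hmin t ht
  simp only [Prod.fst_zero, sub_zero] at h₁
  obtain ⟨h₃, h₄⟩ := hs
  rw [abs_le] at h₁ h₃ h₄
  simp only [InRegion, shift, Prod.fst_add, Prod.snd_add, abs_le]
  omega

end Saturated

end Loz

namespace Search

open Loz

/-- `P` is the set of lozenges of `S` found so far, and `m`, `f`, `g` are the bit sets of `P`, of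
excluded lozenges, and of pairs of sides that have been dealt with. -/
structure Inv (S P : Finset Loz) (r m f g : ℕ) : Prop where
  subset : P ⊆ S
  nonempty : P.Nonempty
  card : P.card + r = 12
  found : ∀ j, 64 ≤ j → (m.testBit j = true ↔ ∃ t ∈ P, j = t.idx ∨ j = t.idx + 1)
  excluded : ∀ t ∈ S, ∀ j, j = t.idx ∨ j = t.idx + 1 → f.testBit j = false
  done : ∀ j, 64 ≤ j → g.testBit j = true → ∃ t ∈ P, ∃ d ≠ t.2, j = slot d t ∧ Done S P d t

theorem le_idx {t : Loz} (h : 0 ≤ t.1.1 + 32 * t.1.2) : 1056 ≤ t.idx := by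
  simp only [idx]; omega

/-- The offset 176 exceeds 4 + 32 * 4, so the masks stay clear of the 64 bits overwritten by `mix`.
-/
theorem le_idx_of_near {t : Loz} (ht : Near 4 t) : 64 ≤ t.idx := by
  simp only [Near, abs_le] at ht
  simp only [idx]; omega

theorem testBit_or_shift {m n x j : ℕ} (hj : 64 ≤ j) :
    (mix (Nat.lor m (Nat.shiftLeft x n))).testBit j =
      (m.testBit j || (decide (n ≤ j) && x.testBit (j - n))) := by
  rw [testBit_mix (by omega)]
  change (m ||| x <<< n).testBit j = _
  rw [Nat.testBit_or, Nat.testBit_shiftLeft]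

variable {S P : Finset Loz} {r m f g : ℕ}

theorem shiftLeft_mask_testBit {l : List Loz} (hl : ∀ t ∈ l, Near 4 t) {u : ℤ × ℤ}
    (hu : 0 ≤ u.1 + 32 * u.2) (j : ℕ) :
    (decide (6 * (u.1 + 32 * u.2).toNat ≤ j) && (mask l).testBit (j - 6 * (u.1 + 32 * u.2).toNat))
      = true ↔ ∃ t ∈ l.map (shift u), j = t.idx ∨ j = t.idx + 1 := by
  rw [Bool.and_eq_true, decide_eq_true_eq, testBit_mask]
  constructor
  · rintro ⟨h, t, ht, h'⟩
    refine ⟨_, List.mem_map_of_mem ht, ?_⟩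
    rw [(hl t ht).idx_shift hu]
    omega
  · rintro ⟨s, hs, h⟩
    obtain ⟨t, ht, rfl⟩ := List.mem_map.1 hs
    rw [(hl t ht).idx_shift hu] at h
    exact ⟨by omega, t, ht, by omega⟩

theorem bit_found (hS : Saturated S) (h0 : ∃ k, ((0, k) : Loz) ∈ S)
    (hmin : ∀ t ∈ S, 0 ≤ t.1.1 + 32 * t.1.2) (hI : Inv S P r m f g) {t : Loz} (ht : t ∈ S) :
    bit m t.idx = if t ∈ P then 1 else 0 := by
  rw [bit_eq]
  have : m.testBit t.idx = true ↔ t ∈ P := by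
    rw [hI.found _ ((by norm_num : 64 ≤ 1056).trans (le_idx (hmin t ht)))]
    constructor
    · rintro ⟨s, hs, h⟩
      rwa [(hS.inRegion h0 hmin ht).idx_eq_or (hS.inRegion h0 hmin (hI.subset hs)) (Or.inl rfl) h]
    · exact fun h => ⟨t, h, Or.inl rfl⟩
  split_ifs with h <;> simp_all

theorem card_insert_three {a b c : Loz} (hab : a ≠ b) (hac : a ≠ c) (hbc : b ≠ c) :
    (insert a (insert b (insert c P))).card +
      ((if a ∈ P then 1 else 0) + ((if b ∈ P then 1 else 0) + if c ∈ P then 1 else 0)) =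
      P.card + 3 := by
  simp only [Finset.card_insert_eq_ite, Finset.mem_insert, hab, hac, hbc, false_or]
  split_ifs <;> omega

/-- The true ribbon of `S` passes every test of `attempt`, and adding it to `P` preserves the
invariant, so the continuation is called on a valid state, where it cannot return `true`. -/
theorem Inv.attempt_false (hS : Saturated S) (h0 : ∃ k, ((0, k) : Loz) ∈ S)
    (hmin : ∀ t ∈ S, 0 ≤ t.1.1 + 32 * t.1.2) (hI : Inv S P r m f g)
    {K : ℕ → ℕ → ℕ → ℕ → Bool}
    (hK : ∀ P r m f g, Inv S P r m f g → K r m f g = true → False)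
    {s : Shape} {u : ℤ × ℤ} (hu : ∃ k, ((u, k) : Loz) ∈ S) {a b c : Loz} (ha : a ∈ S) (hb : b ∈ S)
    (hc : c ∈ S) (hab : IsNext s.dir a b) (hbc : IsNext s.dir b c) (hs : s.chain u = (a, b, c))
    (hprev : ∀ h, a.prev s.dir h ∉ S) (hnext : ∀ h, c.next s.dir h ∉ S)
    (H : attempt K r m f g (6 * (u.1 + 32 * u.2).toNat) s = true) : False := by
  obtain ⟨k, hk⟩ := hu
  have hu' := hmin _ hk
  obtain ⟨na, nb, nc⟩ := s.near
  rw [s.chain_eq] at hs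
  simp only [Prod.mk.injEq] at hs
  obtain ⟨ea, eb, ec⟩ := hs
  set n := 6 * (u.1 + 32 * u.2).toNat with hn
  have hnear : ∀ t ∈ [(s.chain 0).1, (s.chain 0).2.1, (s.chain 0).2.2], Near 2 t := by
    simp [na, nb, nc]
  have hends : ∀ t ∈ ends s.dir (s.chain 0).1 (s.chain 0).2.2, Near 4 t :=
    fun t ht => (na.of_mem_ends nc ht).mono (by norm_num)
  have heq : [(s.chain 0).1, (s.chain 0).2.1, (s.chain 0).2.2].map (shift u) = [a, b, c] := by
    simp [ea, eb, ec]
  have heq' : (ends s.dir (s.chain 0).1 (s.chain 0).2.2).map (shift u) = ends s.dir a c := by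
    rw [← ends_shift, ea, ec]
  have hendsS : ∀ t ∈ ends s.dir a c, t ∉ S := by
    intro t ht
    simp only [ends, List.mem_cons, List.not_mem_nil, or_false] at ht
    rcases ht with rfl | rfl | rfl | rfl
    exacts [hprev _, hprev _, hnext _, hnext _]
  have mem3 : ∀ t ∈ [a, b, c], t ∈ S := by simp [ha, hb, hc]
  have hbody : ∀ j, (decide (n ≤ j) && s.body.testBit (j - n)) = true ↔
      ∃ t ∈ [a, b, c], j = t.idx ∨ j = t.idx + 1 := by
    intro j
    rw [← heq]
    exact shiftLeft_mask_testBit (fun t ht => (hnear t ht).mono (by norm_num)) hu' j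
  have reg : ∀ {t}, t ∈ S → InRegion t := fun ht => hS.inRegion h0 hmin ht
  have regu : ∀ {t}, Near 4 t → InRegion (shift u t) := fun ht => hS.inRegion_shift h0 hmin hk ht
  have d₁ : disj f (Nat.shiftLeft s.body n) = true := by
    rw [disj_eq_true]
    intro j h₁ h₂
    change (s.body <<< n).testBit j = true at h₂
    rw [Nat.testBit_shiftLeft] at h₂
    obtain ⟨t, ht, h⟩ := (hbody j).1 h₂
    rw [hI.excluded t (mem3 t ht) j h] at h₁
    exact absurd h₁ (by simp)
  have d₂ : disj m (Nat.shiftLeft s.exterior n) = true := by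
    rw [disj_eq_true]
    intro j h₁ h₂
    change (s.exterior <<< n).testBit j = true at h₂
    rw [Nat.testBit_shiftLeft] at h₂
    obtain ⟨t, ht, h⟩ := (shiftLeft_mask_testBit hends hu' j).1 h₂
    have ht' := hendsS t (heq' ▸ ht)
    obtain ⟨t', ht'', rfl⟩ := List.mem_map.1 ht
    have hj : 64 ≤ j := by
      have h₃ := le_idx_of_near (hends t' ht'')
      rw [(hends t' ht'').idx_shift hu'] at h
      omega
    obtain ⟨q, hq, h'⟩ := (hI.found j hj).1 h₁
    rw [(regu (hends t' ht'')).idx_eq_or (reg (hI.subset hq)) h h'] at ht'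
    exact ht' (hI.subset hq)
  have hexcl : ∀ t ∈ S, ∀ j, j = t.idx ∨ j = t.idx + 1 →
      (decide (n ≤ j) && s.excluded.testBit (j - n)) = false := by
    intro t ht j hj
    rw [← Bool.not_eq_true]
    intro h
    have hnear' : ∀ t ∈ (s.chain 0).1.overlaps ++ ((s.chain 0).2.1.overlaps ++
        ((s.chain 0).2.2.overlaps ++ ends s.dir (s.chain 0).1 (s.chain 0).2.2)), Near 4 t := by
      intro t ht
      simp only [List.mem_append] at ht
      rcases ht with ht | ht | ht | ht
      exacts [(na.of_mem_overlaps ht).mono (by norm_num), (nb.of_mem_overlaps ht).mono (by norm_num),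
        (nc.of_mem_overlaps ht).mono (by norm_num), hends t ht]
    obtain ⟨q, hq, h'⟩ := (shiftLeft_mask_testBit hnear' hu' j).1 h
    obtain ⟨q', hq', rfl⟩ := List.mem_map.1 hq
    rw [(reg ht).idx_eq_or (regu (hnear' q' hq')) hj h'] at ht
    simp only [List.map_append, ← overlaps_shift, ea, eb, ec, heq', List.mem_append] at hq
    rcases hq with hq | hq | hq | hq
    exacts [hS.notMem_of_mem_overlaps ha hq ht, hS.notMem_of_mem_overlaps hb hq ht,
      hS.notMem_of_mem_overlaps hc hq ht, hendsS _ hq ht]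
  have hslots : ∀ j, (decide (n ≤ j) && s.slots.testBit (j - n)) = true →
      ∃ t ∈ [a, b, c], j = slot s.dir t := by
    intro j h
    rw [Bool.and_eq_true, decide_eq_true_eq] at h
    obtain ⟨h₁, h₂⟩ := h
    have one : ∀ i, (1 <<< i).testBit (j - n) = true → j = i + n := by
      intro i hi
      rw [Nat.one_shiftLeft, Nat.testBit_two_pow] at hi
      simp only [decide_eq_true_eq] at hi
      omega
    simp only [Shape.slots, Nat.testBit_or, Bool.or_eq_true] at h₂
    rcases h₂ with h | h | h
    · exact ⟨a, by simp, by rw [← ea, (na.mono (by norm_num)).slot_shift hu', one _ h]⟩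
    · exact ⟨b, by simp, by rw [← eb, (nb.mono (by norm_num)).slot_shift hu', one _ h]⟩
    · exact ⟨c, by simp, by rw [← ec, (nc.mono (by norm_num)).slot_shift hu', one _ h]⟩
  have hcount : ∀ t ∈ [(s.chain 0).1, (s.chain 0).2.1, (s.chain 0).2.2],
      bit m (t.idx + n) = if shift u t ∈ P then 1 else 0 := by
    intro t ht
    rw [← ((hnear t ht).mono (by norm_num)).idx_shift hu']
    exact bit_found hS h0 hmin hI (mem3 _ (heq ▸ List.mem_map_of_mem ht))
  have h1 : bit m (Nat.add s.idx₁ n) = if a ∈ P then 1 else 0 := ea ▸ hcount _ (by simp)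
  have h2 : bit m (Nat.add s.idx₂ n) = if b ∈ P then 1 else 0 := eb ▸ hcount _ (by simp)
  have h3 : bit m (Nat.add s.idx₃ n) = if c ∈ P then 1 else 0 := ec ▸ hcount _ (by simp)
  have lab := hab.height_lt
  have lbc := hbc.height_lt
  have hcard := card_insert_three (P := P) (a := a) (b := b) (c := c)
    (by rintro rfl; exact lt_irrefl _ lab) (by rintro rfl; exact lt_irrefl _ (lab.trans lbc))
    (by rintro rfl; exact lt_irrefl _ lbc)
  have hsub : insert a (insert b (insert c P)) ⊆ S := by
    intro t ht
    rw [mem_insert_three] at ht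
    exact ht.elim (mem3 t) fun h => hI.subset h
  have hle := Finset.card_le_card hsub
  rw [hS.card] at hle
  have hPr := hI.card
  simp only [attempt, d₁, d₂, cond_true, force_eq, h1, h2, h3] at H
  set w := (if a ∈ P then 1 else 0) + ((if b ∈ P then 1 else 0) + if c ∈ P then 1 else 0) with hw
  -- The union of `P` and the ribbon has `P.card + 3 - w` elements and lies in `S`, which has only
  -- twelve.
  have hr : Nat.ble 3 (Nat.add r w) = true := Nat.ble_eq_true_of_le (by change 3 ≤ r + w; omega)
  have H' : Nat.ble 3 (Nat.add r w) = true := hr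
  simp only [Nat.add_eq] at H hr
  rw [hr, cond_true] at H
  have hPS : P ⊆ insert a (insert b (insert c P)) := fun t ht => mem_insert_three.2 (Or.inr ht)
  have memP : ∀ t ∈ [a, b, c], t ∈ insert a (insert b (insert c P)) :=
    fun t ht => mem_insert_three.2 (Or.inl ht)
  refine hK _ _ _ _ _ ⟨hsub, hI.nonempty.mono hPS, ?_, ?_, ?_, ?_⟩ H
  · change _ + (r + w - 3) = 12
    omega
  · intro j hj
    rw [testBit_or_shift hj, Bool.or_eq_true, hbody, hI.found j hj]
    simp only [mem_insert_three, or_and_right, exists_or]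
    exact or_comm
  · intro t ht j hj
    have h64 : 64 ≤ j := by
      have := le_idx (hmin t ht)
      omega
    rw [testBit_or_shift h64, hI.excluded t ht j hj, hexcl t ht j hj]
    rfl
  · intro j hj h
    rw [testBit_or_shift hj, Bool.or_eq_true] at h
    rcases h with h | h
    · obtain ⟨t, ht, d, hd, h', h''⟩ := hI.done j hj h
      exact ⟨t, hPS ht, d, hd, h', h''.mono hPS⟩
    · obtain ⟨t, ht, h'⟩ := hslots j h
      refine ⟨t, memP t ht, s.dir, ?_, h', ?_⟩
      · simp only [List.mem_cons, List.not_mem_nil, or_false] at ht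
        rcases ht with rfl | rfl | rfl
        exacts [hab.1.symm, hbc.1.symm, hbc.2.1.symm]
      · intro e
        simp only [List.mem_cons, List.not_mem_nil, or_false] at ht
        rcases ht with rfl | rfl | rfl
        · exact ⟨fun h => memP _ (by rw [hS.next_eq hab hb h]; simp), fun h => absurd h (hprev e)⟩
        · exact ⟨fun h => memP _ (by rw [hS.next_eq hbc hc h]; simp),
            fun h => memP _ (by rw [hS.prev_eq hab ha h]; simp)⟩
        · exact ⟨fun h => absurd h (hnext e), fun h => memP _ (by rw [hS.prev_eq hbc hb h]; simp)⟩

theorem Inv.step_false (hS : Saturated S) (h0 : ∃ k, ((0, k) : Loz) ∈ S)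
    (hmin : ∀ t ∈ S, 0 ≤ t.1.1 + 32 * t.1.2) (hI : Inv S P r m f g)
    {K : ℕ → ℕ → ℕ → ℕ → Bool}
    (hK : ∀ P r m f g, Inv S P r m f g → K r m f g = true → False)
    (H : step K r m f g = true) : False := by
  have reg : ∀ {t}, t ∈ P → InRegion t := fun ht => hS.inRegion h0 hmin (hI.subset ht)
  rw [step] at H
  cases hx : Nat.beq (Nat.shiftRight (Nat.xor m g) 1056) 0 with
  | true =>
    rw [hx, cond_true] at H
    have hr : 1 ≤ r := Nat.le_of_ble_eq_true H
    have hmg : ∀ j, 1056 ≤ j → m.testBit j = g.testBit j := by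
      intro j hj
      have h := congrArg (fun x => x.testBit (j - 1056))
        (show (m ^^^ g) >>> 1056 = 0 from Nat.eq_of_beq_eq_true hx)
      simp only [Nat.testBit_shiftRight, Nat.testBit_xor, Nat.zero_testBit,
        Nat.add_sub_cancel' hj] at h
      simpa using h
    -- Each side direction of each lozenge of `P` has its bit in `g`, so `P` contains all neighbours
    -- in `S` of its members.
    have hPS : P = S := by
      refine hS.connected P hI.subset hI.nonempty fun t ht d hd => ?_
      have hidx := le_idx (hmin t (hI.subset ht))
      have hj : 1056 ≤ slot d t := by
        rcases idx_le_slot d t with h | h <;> omega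
      have hm := (hI.found (slot d t) (by omega)).2 ⟨t, ht, idx_le_slot d t⟩
      rw [hmg _ hj] at hm
      obtain ⟨t', ht', d', hd', h, h'⟩ := hI.done _ (by omega) hm
      obtain rfl := (reg ht).idx_eq_or (reg ht') (idx_le_slot d t) (h ▸ idx_le_slot d' t')
      rwa [InRegion.slot_inj hd hd' h]
    have := hI.card
    rw [hPS, hS.card] at this
    omega
  | false =>
    rw [hx, cond_false, force_eq] at H
    set j := low 11 (Nat.shiftRight (Nat.xor m g) 1056)
    cases hb : Nat.beq (bit m (Nat.add 1056 j)) 1 with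
    | false =>
      rw [hb, cond_false] at H
      exact Bool.false_ne_true H
    | true =>
      rw [hb, cond_true, force_eq] at H
      have hm : m.testBit (1056 + j) = true := by
        have h := Nat.eq_of_beq_eq_true hb
        rw [bit_eq] at h
        exact Bool.toNat_eq_one.1 h
      obtain ⟨t, ht, h⟩ := (hI.found _ (by omega)).1 hm
      have htS := hI.subset ht
      obtain ⟨e, he⟩ : ∃ e : Bool, 1056 + j = t.idx + e.toNat :=
        h.elim (fun h => ⟨false, h⟩) (fun h => ⟨true, h⟩)
      -- As 6 divides 1056, the remainder of `j` gives kind and side, and the rest gives the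
      -- position.
      have hmod : Nat.mod j 6 = 2 * t.2.num + e.toNat ∧
          Nat.sub j (Nat.mod j 6) = 6 * (t.1.1 + 32 * t.1.2).toNat := by
        change j % 6 = _ ∧ j - j % 6 = _
        have h₁ := Dir.num_le t.2
        have h₂ := e.toNat_le
        have h₃ := hmin t htS
        have h₄ := (reg ht).idx_eq
        omega
      rw [hmod.2, hmod.1, kinds_eq] at H
      obtain ⟨a, ha, b, hb, c, hc, hab, hbc, htabc, hp, hn⟩ :=
        hS.ribbon t htS (t.2.other e) (Dir.other_ne _ _)
      obtain ⟨p, i, l, hs⟩ := Shape.exists_chain hab hbc htabc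
      exact hI.attempt_false (s := ⟨t.2, e, p, i, l⟩) hS h0 hmin hK ⟨t.2, htS⟩ ha hb hc hab hbc hs hp hn
        (of_attemptAll H p i l)

theorem Inv.search_false (hS : Saturated S) (h0 : ∃ k, ((0, k) : Loz) ∈ S)
    (hmin : ∀ t ∈ S, 0 ≤ t.1.1 + 32 * t.1.2) (n : ℕ) :
    ∀ P r m f g, Inv S P r m f g → search n r m f g = true → False := by
  induction n with
  | zero => intro P r m f g _ h; exact Bool.false_ne_true h
  | succ n ih => exact fun P r m f g hI h => hI.step_false hS h0 hmin ih h

theorem start_false (hS : Saturated S) (hmin : ∀ t ∈ S, 0 ≤ t.1.1 + 32 * t.1.2) {k : Dir}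
    (hk : ((0, k) : Loz) ∈ S) (H : start (0, k) = true) : False := by
  have reg : ∀ {t}, t ∈ S → InRegion t := fun ht => hS.inRegion ⟨k, hk⟩ hmin ht
  simp only [start, force_eq] at H
  refine Inv.search_false hS ⟨k, hk⟩ hmin 12 {(0, k)} _ _ _ _ ⟨by simpa using hk, by simp, rfl, ?_,
    ?_, ?_⟩ H
  · intro j _
    rw [testBit_mask]
    simp
  · intro t ht j hj
    have h₁ := le_idx (hmin t ht)
    rw [Nat.testBit_or, Nat.testBit_two_pow_sub_one, Bool.or_eq_false_iff]
    refine ⟨by simp; omega, ?_⟩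
    rw [← Bool.not_eq_true, testBit_mask]
    rintro ⟨s, hs, h⟩
    have n1 : Near 1 s := Near.of_mem_overlaps (n := 0) (by simp [Near]) hs
    have hreg : InRegion s := by
      have := hS.inRegion_shift ⟨k, hk⟩ hmin hk (n1.mono (by norm_num))
      rwa [show shift ((0, k) : Loz).1 s = s by simp [shift]] at this
    rw [(reg ht).idx_eq_or hreg hj h] at ht
    exact hS.notMem_of_mem_overlaps hk hs ht
  · intro j _ h
    simp at h

end Search

/-! ### Reduction to a first lozenge at the origin -/

namespace Loz

theorem Saturated.image_shift {S : Finset Loz} (hS : Saturated S) (u : ℤ × ℤ) :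
    Saturated (S.image (shift u)) := by
  have mem : ∀ t, shift u t ∈ S.image (shift u) ↔ t ∈ S := fun t =>
    ⟨fun h => by
      obtain ⟨s, hs, h⟩ := Finset.mem_image.1 h
      rwa [← shift_injective u h], Finset.mem_image_of_mem _⟩
  refine ⟨?_, ?_, ?_, ?_, ?_, ?_⟩
  · simp only [Finset.forall_mem_image]
    intro s hs t ht h
    rw [hS.eq_of_up s hs t ht (by simpa [shift] using h)]
  · simp only [Finset.forall_mem_image]
    intro s hs t ht h
    rw [hS.eq_of_dn s hs t ht (by simpa [shift, dn_add] using h)]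
  · simp only [Finset.forall_mem_image]
    intro t ht d hd
    obtain ⟨a, ha, b, hb, c, hc, hab, hbc, h, hp, hn⟩ := hS.ribbon t ht d hd
    refine ⟨_, (mem a).2 ha, _, (mem b).2 hb, _, (mem c).2 hc, hab.shift u, hbc.shift u, ?_, ?_, ?_⟩
    · rcases h with rfl | rfl | rfl <;> simp
    · intro e; rw [prev_shift, mem]; exact hp e
    · intro e; rw [next_shift, mem]; exact hn e
  · intro P hP hne hcl
    obtain ⟨Q, hQ, rfl⟩ := Finset.subset_image_iff.1 hP
    have memQ : ∀ t, shift u t ∈ Q.image (shift u) ↔ t ∈ Q := fun t =>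
      ⟨fun h => by
        obtain ⟨s, hs, h⟩ := Finset.mem_image.1 h
        rwa [← shift_injective u h], Finset.mem_image_of_mem _⟩
    rw [hS.connected Q hQ (Finset.image_nonempty.1 hne)]
    intro t ht d hd e
    simpa only [next_shift, prev_shift, mem, memQ] using hcl _ ((memQ t).2 ht) d hd e
  · rw [Finset.card_image_of_injective _ (shift_injective u), hS.card]
  · simp only [Finset.forall_mem_image]
    intro s hs t ht
    simpa [shift] using hS.bounded s hs t ht

theorem not_saturated (S : Finset Loz) : ¬ Saturated S := by
  intro hS
  obtain ⟨t₀, ht₀, hmin⟩ := S.exists_min_image (fun t => t.1.1 + 32 * t.1.2)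
    (Finset.card_pos.1 (by rw [hS.card]; norm_num))
  have hk : ((0, t₀.2) : Loz) ∈ S.image (shift (-t₀.1)) :=
    Finset.mem_image.2 ⟨t₀, ht₀, by simp [shift]⟩
  have hmin' : ∀ t ∈ S.image (shift (-t₀.1)), 0 ≤ t.1.1 + 32 * t.1.2 := by
    simp only [Finset.forall_mem_image]
    intro t ht
    have := hmin t ht
    simp only [shift, Prod.fst_add, Prod.snd_add, Prod.fst_neg, Prod.snd_neg]
    omega
  refine Search.start_false (hS.image_shift _) hmin' hk ?_
  cases t₀.2
  exacts [Search.start_x, Search.start_y, Search.start_z]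

end Loz
end Tredoku

/-! ### Tiles as lozenges of one lattice -/

namespace Tredoku

theorem omega_re : omega.re = 1 / 2 := by
  rw [omega, Complex.exp_ofReal_mul_I_re, Real.cos_pi_div_three]

theorem omega_im : omega.im = √3 / 2 := by
  rw [omega, Complex.exp_ofReal_mul_I_im, Real.sin_pi_div_three]

theorem omega_sq : omega ^ 2 = omega - 1 := by
  have h : √3 * √3 = 3 := Real.mul_self_sqrt (by norm_num)
  apply Complex.ext
  · simp only [sq, Complex.mul_re, Complex.sub_re, Complex.one_re, omega_re, omega_im]
    linarith
  · simp only [sq, Complex.mul_im, Complex.sub_im, Complex.one_im, omega_re, omega_im]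
    ring

theorem norm_omega : ‖omega‖ = 1 := by rw [omega, Complex.norm_exp_ofReal_mul_I]

theorem add_mul_omega_inj {w : ℂ} (hw : w ≠ 0) {x y x' y' : ℝ}
    (h : (x + y * omega) * w = (x' + y' * omega) * w) : x = x' ∧ y = y' := by
  have h := mul_right_cancel₀ hw h
  have him := congrArg Complex.im h
  have hre := congrArg Complex.re h
  simp [omega_re, omega_im] at him hre
  obtain rfl := him
  exact ⟨by simpa using hre, rfl⟩

/-- A point of the triangular lattice with origin `o` and unit `w`. -/
noncomputable def pos (o w : ℂ) (p : ℤ × ℤ) : ℂ := o + (p.1 + p.2 * omega) * w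

/-- The side of direction `e.2` of the up triangle `e.1` has the end points `e.src` and `e.tgt`. -/
def Loz.src (e : Loz) : ℤ × ℤ :=
  match e.2 with
  | .x | .y => e.1
  | .z => (e.1.1 + 1, e.1.2)

def Loz.tgt (e : Loz) : ℤ × ℤ :=
  match e.2 with
  | .x => (e.1.1 + 1, e.1.2)
  | .y | .z => (e.1.1, e.1.2 + 1)

/-- A `Loz` doubles as a name for a lattice edge, the one that it straddles. The sides of `t` are
thus named by the members of `t.overlaps`. -/
def seg (o w : ℂ) (e : Loz) : Set ℂ := segment ℝ (pos o w e.src) (pos o w e.tgt)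

section

variable {o w : ℂ}

theorem pos_injective (hw : w ≠ 0) : Function.Injective (pos o w) := by
  intro p q h
  have h : ((p.1 : ℝ) + (p.2 : ℝ) * omega) * w = ((q.1 : ℝ) + (q.2 : ℝ) * omega) * w := by
    simpa [pos] using h
  obtain ⟨h₁, h₂⟩ := add_mul_omega_inj hw h
  exact Prod.ext (by exact_mod_cast h₁) (by exact_mod_cast h₂)

theorem eq_or_eq_of_pos_mem_seg (hw : w ≠ 0) {q : ℤ × ℤ} {e : Loz} (h : pos o w q ∈ seg o w e) :
    q = e.src ∨ q = e.tgt := by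
  rw [seg, segment_eq_image'] at h
  obtain ⟨θ, ⟨h0, h1⟩, h⟩ := h
  have h : ((e.src.1 + θ * (e.tgt.1 - e.src.1) : ℝ) + (e.src.2 + θ * (e.tgt.2 - e.src.2) : ℝ) *
      omega) * w = ((q.1 : ℝ) + (q.2 : ℝ) * omega) * w := by
    simp only [pos, Complex.real_smul] at h
    push_cast
    linear_combination h
  obtain ⟨h₁, h₂⟩ := add_mul_omega_inj hw h
  obtain ⟨⟨a, b⟩, d⟩ := e
  obtain ⟨q₁, q₂⟩ := q
  cases d <;> simp [Loz.src, Loz.tgt] at h₁ h₂ ⊢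
  · have l : (a : ℝ) ≤ q₁ := by linarith
    have r : (q₁ : ℝ) ≤ a + 1 := by linarith
    norm_cast at l r h₂
    omega
  · have l : (b : ℝ) ≤ q₂ := by linarith
    have r : (q₂ : ℝ) ≤ b + 1 := by linarith
    norm_cast at l r h₁
    omega
  · have l : (b : ℝ) ≤ q₂ := by linarith
    have r : (q₂ : ℝ) ≤ b + 1 := by linarith
    have s : (q₁ : ℝ) + q₂ = a + b + 1 := by linarith
    norm_cast at l r s
    omega

theorem seg_injective (hw : w ≠ 0) : Function.Injective (seg o w) := by
  intro e e' h
  have h₁ : pos o w e.src ∈ seg o w e' := h ▸ left_mem_segment ℝ _ _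
  have h₂ : pos o w e.tgt ∈ seg o w e' := h ▸ right_mem_segment ℝ _ _
  replace h₁ := eq_or_eq_of_pos_mem_seg hw h₁
  replace h₂ := eq_or_eq_of_pos_mem_seg hw h₂
  obtain ⟨⟨a, b⟩, d⟩ := e
  obtain ⟨⟨a', b'⟩, d'⟩ := e'
  cases d <;> cases d' <;> simp [Loz.src, Loz.tgt] at h₁ h₂ ⊢ <;> omega

theorem affineSpan_segment_eq (a b : ℂ) : affineSpan ℝ (segment ℝ a b) = line[ℝ, a, b] := by
  rw [← convexHull_pair, affineSpan_convexHull]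

theorem parallelSides_seg (hw : w ≠ 0) {e e' : Loz} :
    ParallelSides (seg o w e) (seg o w e') ↔ e.2 = e'.2 := by
  have key : ∀ e : Loz, pos o w e.tgt - pos o w e.src =
      ((e.tgt.1 - e.src.1 : ℝ) + (e.tgt.2 - e.src.2 : ℝ) * omega) * w := by
    intro e
    simp only [pos]
    push_cast
    ring
  rw [ParallelSides, seg, seg, affineSpan_segment_eq, affineSpan_segment_eq,
    AffineSubspace.affineSpan_pair_parallel_iff_vectorSpan_eq, vectorSpan_pair_rev,
    vectorSpan_pair_rev, vsub_eq_sub, vsub_eq_sub]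
  constructor
  · intro h
    have h' : pos o w e'.tgt - pos o w e'.src ∈
        Submodule.span ℝ {pos o w e.tgt - pos o w e.src} :=
      h ▸ Submodule.mem_span_singleton_self _
    obtain ⟨r, hr⟩ := Submodule.mem_span_singleton.1 h'
    have hr : ((r * (e.tgt.1 - e.src.1) : ℝ) + (r * (e.tgt.2 - e.src.2) : ℝ) * omega) * w =
        ((e'.tgt.1 - e'.src.1 : ℝ) + (e'.tgt.2 - e'.src.2 : ℝ) * omega) * w := by
      rw [← key, ← hr, key, Complex.real_smul]
      push_cast
      ring
    obtain ⟨h₁, h₂⟩ := add_mul_omega_inj hw (by exact_mod_cast hr)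
    obtain ⟨⟨a, b⟩, d⟩ := e
    obtain ⟨⟨a', b'⟩, d'⟩ := e'
    cases d <;> cases d' <;> simp [Loz.src, Loz.tgt] at h₁ h₂ ⊢ <;> linarith
  · intro h
    have h₁ : e.tgt.1 - e.src.1 = e'.tgt.1 - e'.src.1 := by simp [Loz.src, Loz.tgt, h]; split <;> simp
    have h₂ : e.tgt.2 - e.src.2 = e'.tgt.2 - e'.src.2 := by simp [Loz.src, Loz.tgt, h]; split <;> simp
    rw [key, key]
    norm_cast
    rw [h₁, h₂]

/-- The parameters of `c` and `d` along the first segment lie in `[0, 1]` and differ by 1, so they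
are 0 and 1. -/
theorem eq_and_eq_or_of_segment_eq {a b c d : ℂ} (hab : ‖b - a‖ = 1) (hcd : ‖d - c‖ = 1)
    (h : segment ℝ a b = segment ℝ c d) : c = a ∧ d = b ∨ c = b ∧ d = a := by
  have hc : c ∈ segment ℝ a b := h ▸ left_mem_segment ℝ c d
  have hd : d ∈ segment ℝ a b := h ▸ right_mem_segment ℝ c d
  rw [segment_eq_image'] at hc hd
  obtain ⟨s, ⟨hs, hs'⟩, rfl⟩ := hc
  obtain ⟨t, ⟨ht, ht'⟩, rfl⟩ := hd
  have : ‖(t - s) • (b - a)‖ = 1 := by rw [← hcd]; congr 1; module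
  rw [norm_smul, hab, mul_one, Real.norm_eq_abs] at this
  rcases (abs_eq zero_le_one).1 this with h | h
  · obtain rfl : s = 0 := by linarith
    obtain rfl : t = 1 := by linarith
    left; constructor <;> module
  · obtain rfl : s = 1 := by linarith
    obtain rfl : t = 0 := by linarith
    right; constructor <;> module

theorem omega_pow_three : omega ^ 3 = -1 := by
  linear_combination (omega + 1) * omega_sq

theorem omega_pow_six : omega ^ 6 = 1 := by
  linear_combination (omega ^ 3 - 1) * omega_pow_three

theorem exists_omega_pow_eq (j : ℕ) : ∃ x y : ℤ, omega ^ j = x + y * omega := by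
  induction j with
  | zero => exact ⟨1, 0, by simp⟩
  | succ j ih =>
    obtain ⟨x, y, h⟩ := ih
    refine ⟨-y, x + y, ?_⟩
    push_cast
    linear_combination omega * h + y * omega_sq

theorem exists_pos_add (p : ℤ × ℤ) (j : ℕ) : ∃ q, pos o w p + omega ^ j * w = pos o w q := by
  obtain ⟨x, y, h⟩ := exists_omega_pow_eq j
  refine ⟨(p.1 + x, p.2 + y), ?_⟩
  simp only [pos, h]
  push_cast
  ring

/-- The tile `A` is placed on the lattice with origin `o` and unit `w`. -/
def OnLattice (o w : ℂ) (A : Tile) : Prop :=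
  (∃ p, A.base = pos o w p) ∧ ∃ j : ℕ, A.dir = omega ^ j * w

theorem onLattice_self (A : Tile) : OnLattice A.base A.dir A :=
  ⟨⟨0, by simp [pos]⟩, 0, by simp⟩

theorem OnLattice.exists_side {A : Tile} (hA : OnLattice o w A) {s : Set ℂ} (hs : s ∈ A.sides) :
    ∃ p, ∃ j : ℕ, s = segment ℝ (pos o w p) (pos o w p + omega ^ j * w) := by
  obtain ⟨⟨p, hp⟩, j, hj⟩ := hA
  simp only [Tile.sides, Tile.dir', hp, hj, Set.mem_insert_iff, Set.mem_singleton_iff] at hs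
  rcases hs with rfl | rfl | rfl | rfl
  · exact ⟨p, j, rfl⟩
  · obtain ⟨q, hq⟩ := exists_pos_add (o := o) (w := w) p j
    exact ⟨q, j + 1, by rw [← hq, pow_succ]; congr 1; ring⟩
  · obtain ⟨q, hq⟩ := exists_pos_add (o := o) (w := w) p (j + 1)
    exact ⟨q, j, by rw [← hq, pow_succ]; congr 1 <;> ring⟩
  · exact ⟨p, j + 1, by rw [pow_succ]; congr 1; ring⟩

theorem exists_pos_sub {z : ℂ} {q : ℤ × ℤ} {j : ℕ} (h : z + omega ^ j * w = pos o w q) :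
    ∃ p, z = pos o w p := by
  obtain ⟨p, hp⟩ := exists_pos_add (o := o) (w := w) q (j + 3)
  refine ⟨p, ?_⟩
  rw [← hp, ← h, pow_add, omega_pow_three]
  ring

/-- A common side agrees with a lattice edge up to reversal, which adds 3 to the exponent of
`omega`; the other side vector of the tile differs by one more power of `omega`. -/
theorem onLattice_of_side (hw : ‖w‖ = 1) {B : Tile} {p : ℤ × ℤ} {j : ℕ}
    (h : segment ℝ (pos o w p) (pos o w p + omega ^ j * w) ∈ B.sides) : OnLattice o w B := by
  have orient : ∀ c d : ℂ, ‖d - c‖ = 1 →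
      segment ℝ (pos o w p) (pos o w p + omega ^ j * w) = segment ℝ c d →
      ∃ q, ∃ i : ℕ, c = pos o w q ∧ d = c + omega ^ i * w := by
    intro c d hcd h
    rcases eq_and_eq_or_of_segment_eq (by simp [norm_omega, hw]) hcd h with ⟨h₁, h₂⟩ | ⟨h₁, h₂⟩
    · exact ⟨p, j, h₁, by rw [h₁, h₂]⟩
    · obtain ⟨q, hq⟩ := exists_pos_add (o := o) (w := w) p j
      refine ⟨q, j + 3, by rw [h₁, hq], ?_⟩
      rw [h₁, h₂, pow_add, omega_pow_three]
      ring
  have turn : ∀ i : ℕ, B.dir' = omega ^ i * w → B.dir = omega ^ (i + 5) * w := by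
    intro i hi
    rw [Tile.dir'] at hi
    linear_combination omega ^ 5 * hi - B.dir * omega_pow_six
  have hB' : ‖B.dir'‖ = 1 := by rw [Tile.dir', norm_mul, norm_omega, B.norm_dir, one_mul]
  have hB := B.norm_dir
  simp only [Tile.sides, Set.mem_insert_iff, Set.mem_singleton_iff] at h
  rcases h with h | h | h | h <;> obtain ⟨q, i, hc, hd⟩ := orient _ _ (by simpa) h
  · exact ⟨⟨q, hc⟩, i, add_left_cancel hd⟩
  · have h' := turn i (add_left_cancel hd)
    exact ⟨exists_pos_sub (h' ▸ hc), _, h'⟩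
  · have h' : B.dir = omega ^ i * w := by linear_combination hd
    refine ⟨exists_pos_sub (j := i + 1) (q := q) ?_, _, h'⟩
    rw [← hc, Tile.dir', h', pow_succ]
    ring
  · exact ⟨⟨q, hc⟩, _, turn i (add_left_cancel hd)⟩

/-- The tile `A` is the lozenge `t` of the lattice with origin `o` and unit `w`. -/
structure Rep (o w : ℂ) (A : Tile) (t : Loz) : Prop where
  up : ∀ p ∈ [t.1, (t.1.1 + 1, t.1.2), (t.1.1, t.1.2 + 1)], pos o w p ∈ A.vertices
  dn : ∀ p ∈ [((Loz.dn t.1 t.2).1 + 1, (Loz.dn t.1 t.2).2),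
    ((Loz.dn t.1 t.2).1, (Loz.dn t.1 t.2).2 + 1),
    ((Loz.dn t.1 t.2).1 + 1, (Loz.dn t.1 t.2).2 + 1)], pos o w p ∈ A.vertices
  mem_sides : ∀ s, s ∈ A.sides ↔ ∃ e ∈ t.overlaps, s = seg o w e

theorem OnLattice.exists_rep {A : Tile} (hA : OnLattice o w A) : ∃ t, Rep o w A t := by
  obtain ⟨⟨⟨a, b⟩, hp⟩, j, hj⟩ := hA
  have hj : A.dir = omega ^ (j % 6) * w := by
    rw [hj]
    nth_rewrite 1 [← Nat.div_add_mod j 6]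
    rw [pow_add, pow_mul, omega_pow_six, one_pow, one_mul]
  have hj6 := Nat.mod_lt j (by norm_num : 0 < 6)
  have corners : ∀ q₁ q₂ q₃ : ℤ × ℤ, pos o w (a, b) + A.dir = pos o w q₁ →
      pos o w (a, b) + A.dir + A.dir' = pos o w q₂ → pos o w (a, b) + A.dir' = pos o w q₃ →
      ∀ t : Loz, 
      (∀ p ∈ [t.1, (t.1.1 + 1, t.1.2), (t.1.1, t.1.2 + 1)] ++
        [((Loz.dn t.1 t.2).1 + 1, (Loz.dn t.1 t.2).2),
        ((Loz.dn t.1 t.2).1, (Loz.dn t.1 t.2).2 + 1),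
        ((Loz.dn t.1 t.2).1 + 1, (Loz.dn t.1 t.2).2 + 1)], p ∈ [(a, b), q₁, q₂, q₃]) →
      (∀ s, s ∈ [segment ℝ (pos o w (a, b)) (pos o w q₁), segment ℝ (pos o w q₁) (pos o w q₂),
        segment ℝ (pos o w q₃) (pos o w q₂), segment ℝ (pos o w (a, b)) (pos o w q₃)] ↔
        s ∈ t.overlaps.map (seg o w)) → Rep o w A t := by
    intro q₁ q₂ q₃ h₁ h₂ h₃ t hv hs
    rw [h₁] at h₂
    have hv' : ∀ p ∈ [(a, b), q₁, q₂, q₃], pos o w p ∈ A.vertices := by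
      simp [Tile.vertices, hp, h₁, h₂, h₃]
    refine ⟨fun p h => hv' p (hv p (List.mem_append_left _ h)),
      fun p h => hv' p (hv p (List.mem_append_right _ h)), fun s => ?_⟩
    have := hs s
    simp only [List.mem_map] at this
    simp only [Tile.sides, hp, h₁, h₂, h₃]
    simpa [eq_comm] using this
  generalize j % 6 = i at hj hj6
  have h' : A.dir' = omega ^ (i + 1) * w := by rw [Tile.dir', hj]; ring
  have e₂ := omega_sq
  have e₃ := omega_pow_three
  have e₄ : omega ^ 4 = -omega := by linear_combination omega * e₃
  have e₅ : omega ^ 5 = 1 - omega := by linear_combination omega ^ 2 * e₃ - e₂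
  -- Opposite exponents give the same kind, seen from the other acute vertex: 0 and 3 give `z`, 1
  -- and 4 give `x`, 2 and 5 give `y`. Reversing segments makes them run from `src` to `tgt`.
  interval_cases i
  · refine ⟨_, corners (a + 1, b) (a + 1, b + 1) (a, b + 1) ?_ ?_ ?_ ((a, b), .z) ?_ ?_⟩
    iterate 3
      simp only [pos, hj, h', zero_add, pow_zero, pow_one]
      push_cast
      ring
    · simp [Loz.dn]
    · intro s
      simp [Loz.overlaps, seg, Loz.src, Loz.tgt, Loz.dn, Loz.up, Dir.other]
      tauto
  · refine ⟨_, corners (a, b + 1) (a - 1, b + 1 + 1) (a - 1, b + 1) ?_ ?_ ?_ ((a - 1, b + 1), .x) ?_ ?_⟩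
    iterate 3
      simp only [pos, hj, h', Nat.reduceAdd, pow_one, e₂]
      push_cast
      ring
    · simp [Loz.dn]
    · intro s
      simp [Loz.overlaps, seg, Loz.src, Loz.tgt, Loz.dn, Loz.up, Dir.other]
      tauto
  · refine ⟨_, corners (a - 1, b + 1) (a - 1 - 1, b + 1) (a - 1, b) ?_ ?_ ?_ ((a - 1, b), .y) ?_ ?_⟩
    iterate 3
      simp only [pos, hj, h', Nat.reduceAdd, e₂, e₃]
      push_cast
      ring
    · simp [Loz.dn]
    · intro s
      rw [segment_symm ℝ (pos o w (a - 1, b + 1)) (pos o w (a - 1 - 1, b + 1)), segment_symm ℝ (pos o w (a, b)) (pos o w (a - 1, b))]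
      simp [Loz.overlaps, seg, Loz.src, Loz.tgt, Loz.dn, Loz.up, Dir.other]
      tauto
  · refine ⟨_, corners (a - 1, b) (a - 1, b - 1) (a, b - 1) ?_ ?_ ?_ ((a - 1, b - 1), .z) ?_ ?_⟩
    iterate 3
      simp only [pos, hj, h', Nat.reduceAdd, e₃, e₄]
      push_cast
      ring
    · simp [Loz.dn]
    · intro s
      rw [segment_symm ℝ (pos o w (a, b)) (pos o w (a - 1, b)), segment_symm ℝ (pos o w (a - 1, b)) (pos o w (a - 1, b - 1)), segment_symm ℝ (pos o w (a, b - 1)) (pos o w (a - 1, b - 1)), segment_symm ℝ (pos o w (a, b)) (pos o w (a, b - 1))]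
      simp [Loz.overlaps, seg, Loz.src, Loz.tgt, Loz.dn, Loz.up, Dir.other]
      tauto
  · refine ⟨_, corners (a, b - 1) (a + 1, b - 1 - 1) (a + 1, b - 1) ?_ ?_ ?_ ((a, b - 1), .x) ?_ ?_⟩
    iterate 3
      simp only [pos, hj, h', Nat.reduceAdd, e₄, e₅]
      push_cast
      ring
    · simp [Loz.dn]
    · intro s
      rw [segment_symm ℝ (pos o w (a, b)) (pos o w (a, b - 1)), segment_symm ℝ (pos o w (a, b - 1)) (pos o w (a + 1, b - 1 - 1)), segment_symm ℝ (pos o w (a + 1, b - 1)) (pos o w (a + 1, b - 1 - 1)), segment_symm ℝ (pos o w (a, b)) (pos o w (a + 1, b - 1))]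
      simp [Loz.overlaps, seg, Loz.src, Loz.tgt, Loz.dn, Loz.up, Dir.other]
      tauto
  · refine ⟨_, corners (a + 1, b - 1) (a + 1 + 1, b - 1) (a + 1, b) ?_ ?_ ?_ ((a + 1, b - 1), .y) ?_ ?_⟩
    iterate 3
      simp only [pos, hj, h', Nat.reduceAdd, e₅, omega_pow_six]
      push_cast
      ring
    · simp [Loz.dn]
    · intro s
      rw [segment_symm ℝ (pos o w (a, b)) (pos o w (a + 1, b - 1)), segment_symm ℝ (pos o w (a + 1, b)) (pos o w (a + 1 + 1, b - 1))]
      simp [Loz.overlaps, seg, Loz.src, Loz.tgt, Loz.dn, Loz.up, Dir.other]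
      tauto

end

end Tredoku

/-! ### From tilings to saturated sets -/

namespace Tredoku

instance : Fintype Dir := ⟨{.x, .y, .z}, fun d => by cases d <;> decide⟩

open Loz

namespace Loz

theorem mem_overlaps_iff {e t : Loz} :
    e ∈ t.overlaps ↔ e.2 ≠ t.2 ∧ (e.1 = t.1 ∨ dn e.1 e.2 = dn t.1 t.2) := by
  obtain ⟨u, d⟩ := e
  obtain ⟨v, k⟩ := t
  have up_iff : u = up (dn v k) d ↔ dn u d = dn v k :=
    ⟨fun h => by rw [h, dn_up], fun h => by rw [← h, up_dn]⟩
  simp only [overlaps, List.mem_cons, List.not_mem_nil, or_false, Prod.mk.injEq]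
  constructor
  · rintro (⟨h, rfl⟩ | ⟨h, rfl⟩ | ⟨h, rfl⟩ | ⟨h, rfl⟩)
    exacts [⟨Dir.other_ne _ _, Or.inl h⟩, ⟨Dir.other_ne _ _, Or.inl h⟩,
      ⟨Dir.other_ne _ _, Or.inr (up_iff.1 h)⟩, ⟨Dir.other_ne _ _, Or.inr (up_iff.1 h)⟩]
  · rintro ⟨hd, h⟩
    obtain ⟨e, rfl⟩ := Dir.exists_other hd
    rw [← up_iff] at h
    cases e <;> tauto

theorem abs_next_sub_le {d : Dir} {a b : Loz} (h : IsNext d a b) : |b.1.1 - a.1.1| ≤ 1 := by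
  obtain ⟨e, rfl⟩ := h.exists_next
  rw [abs_le]
  cases d <;> cases e <;> simp only [next, dn, up, Dir.other] <;> omega

end Loz

variable {𝒯 : Finset Tile} {o w : ℂ} {f : Tile → Loz}

/-- Distinct tiles meet at most in a vertex or a side, and a side contains only two lattice points.
-/
theorem IsTredoku.eq_of_common_vertices (h : IsTredoku 𝒯) (hw : w ≠ 0) {A B : Tile} (hA : A ∈ 𝒯)
    (hB : B ∈ 𝒯) {p q r : ℤ × ℤ} (hpq : p ≠ q) (hpr : p ≠ r) (hqr : q ≠ r)
    (hv : ∀ x ∈ [p, q, r], pos o w x ∈ A.vertices ∧ pos o w x ∈ B.vertices)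
    (hs : ∀ s ∈ A.sides, ∃ e, s = seg o w e) : A = B := by
  by_contra hne
  have hmem : ∀ x ∈ [p, q, r], pos o w x ∈ A.body ∩ B.body := fun x hx =>
    ⟨subset_convexHull ℝ _ (hv x hx).1, subset_convexHull ℝ _ (hv x hx).2⟩
  rcases h.touch A hA B hB hne with h₀ | ⟨v, -, -, h₀⟩ | ⟨s, hsA, -, h₀⟩
  · have := hmem p (by simp)
    rw [h₀] at this
    exact this
  · have hp := hmem p (by simp)
    have hq := hmem q (by simp)
    rw [h₀, Set.mem_singleton_iff] at hp hq
    exact hpq (pos_injective hw (hp.trans hq.symm))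
  · obtain ⟨e, rfl⟩ := hs s hsA
    have hx := fun x hx => eq_or_eq_of_pos_mem_seg hw (h₀ ▸ hmem x hx)
    have hp := hx p (by simp)
    have hq := hx q (by simp)
    have hr := hx r (by simp)
    grind

theorem IsTredoku.exists_onLattice (h : IsTredoku 𝒯) : ∃ o w, ‖w‖ = 1 ∧
    ∀ A ∈ 𝒯, OnLattice o w A := by
  obtain ⟨A₀⟩ := h.connected.nonempty
  refine ⟨A₀.1.base, A₀.1.dir, A₀.1.norm_dir, fun A hA => ?_⟩
  have hr := (SimpleGraph.reachable_iff_reflTransGen _ _).1 (h.connected.preconnected A₀ ⟨A, hA⟩)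
  suffices ∀ B : 𝒯, Relation.ReflTransGen (dualGraph 𝒯).Adj A₀ B →
      OnLattice A₀.1.base A₀.1.dir B.1 from this _ hr
  intro B hB
  induction hB with
  | refl => exact onLattice_self _
  | tail _ hadj ih =>
    obtain ⟨-, s, hs, hs'⟩ := hadj
    obtain ⟨p, j, rfl⟩ := ih.exists_side hs
    exact onLattice_of_side A₀.1.norm_dir hs'

/-- All tiles are lozenges of the lattice with origin `o` and unit `w`. -/
structure Placed (𝒯 : Finset Tile) (o w : ℂ) (f : Tile → Loz) : Prop where
  tredoku : IsTredoku 𝒯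
  ne_zero : w ≠ 0
  rep : ∀ A ∈ 𝒯, Rep o w A (f A)

theorem IsTredoku.exists_placed (h : IsTredoku 𝒯) : ∃ o w f, Placed 𝒯 o w f := by
  obtain ⟨o, w, hw, H⟩ := h.exists_onLattice
  have : ∀ A, ∃ t, A ∈ 𝒯 → Rep o w A t := fun A => by
    by_cases hA : A ∈ 𝒯
    · obtain ⟨t, ht⟩ := (H A hA).exists_rep
      exact ⟨t, fun _ => ht⟩
    · exact ⟨(0, .x), fun h => absurd h hA⟩
  choose f hf using this
  exact ⟨o, w, f, h, by rintro rfl; simp at hw, hf⟩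

namespace Placed

variable (H : Placed 𝒯 o w f)
include H

theorem exists_seg {A : Tile} (hA : A ∈ 𝒯) : ∀ s ∈ A.sides, ∃ e, s = seg o w e := fun s hs => by
  obtain ⟨e, -, he⟩ := ((H.rep A hA).mem_sides s).1 hs
  exact ⟨e, he⟩

theorem eq_of_up {A B : Tile} (hA : A ∈ 𝒯) (hB : B ∈ 𝒯) (h : (f A).1 = (f B).1) : A = B := by
  refine H.tredoku.eq_of_common_vertices H.ne_zero hA hB (p := (f A).1)
    (q := ((f A).1.1 + 1, (f A).1.2)) (r := ((f A).1.1, (f A).1.2 + 1)) ?_ ?_ ?_ ?_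
    (H.exists_seg hA)
  · simp [Prod.ext_iff]
  · simp [Prod.ext_iff]
  · simp
  · exact fun x hx => ⟨(H.rep A hA).up x hx, (H.rep B hB).up x (h ▸ hx)⟩

theorem eq_of_dn {A B : Tile} (hA : A ∈ 𝒯) (hB : B ∈ 𝒯)
    (h : Loz.dn (f A).1 (f A).2 = Loz.dn (f B).1 (f B).2) : A = B := by
  refine H.tredoku.eq_of_common_vertices H.ne_zero hA hB
    (p := ((Loz.dn (f A).1 (f A).2).1 + 1, (Loz.dn (f A).1 (f A).2).2))
    (q := ((Loz.dn (f A).1 (f A).2).1, (Loz.dn (f A).1 (f A).2).2 + 1))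
    (r := ((Loz.dn (f A).1 (f A).2).1 + 1, (Loz.dn (f A).1 (f A).2).2 + 1)) ?_ ?_ ?_ ?_
    (H.exists_seg hA)
  · simp
  · simp
  · simp
  · exact fun x hx => ⟨(H.rep A hA).dn x hx, (H.rep B hB).dn x (h ▸ hx)⟩

theorem injOn {A B : Tile} (hA : A ∈ 𝒯) (hB : B ∈ 𝒯) (h : f A = f B) : A = B :=
  H.eq_of_up hA hB (congrArg Prod.fst h)

/-- The common side borders one up and one down triangle. Distinct tiles share no triangle, so each
tile contains one of these two. -/
theorem exists_isNext {A B : Tile} (hA : A ∈ 𝒯) (hB : B ∈ 𝒯) (hne : A ≠ B) {s : Set ℂ}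
    (hsA : s ∈ A.sides) (hsB : s ∈ B.sides) :
    ∃ e, s = seg o w e ∧ (IsNext e.2 (f A) (f B) ∨ IsNext e.2 (f B) (f A)) := by
  obtain ⟨e, he, rfl⟩ := ((H.rep A hA).mem_sides s).1 hsA
  obtain ⟨e', he', heq⟩ := ((H.rep B hB).mem_sides _).1 hsB
  obtain rfl := seg_injective H.ne_zero heq
  rw [mem_overlaps_iff] at he he'
  refine ⟨e, rfl, ?_⟩
  obtain ⟨dA, hA'⟩ := he
  obtain ⟨dB, hB'⟩ := he'
  rcases hA' with hA' | hA' <;> rcases hB' with hB' | hB'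
  · exact absurd (H.eq_of_up hA hB (hA'.symm.trans hB')) hne
  · exact Or.inl ⟨dA.symm, dB.symm, hA' ▸ hB'⟩
  · exact Or.inr ⟨dB.symm, dA.symm, hB' ▸ hA'⟩
  · exact absurd (H.eq_of_dn hA hB (hA'.symm.trans hB')) hne

theorem seg_mem_sides {A B : Tile} (hA : A ∈ 𝒯) (hB : B ∈ 𝒯) {d : Dir}
    (h : IsNext d (f A) (f B)) :
    seg o w ((f A).1, d) ∈ A.sides ∧ seg o w ((f A).1, d) ∈ B.sides :=
  ⟨((H.rep A hA).mem_sides _).2 ⟨((f A).1, d), mem_overlaps_iff.2 ⟨h.1.symm, Or.inl rfl⟩, rfl⟩,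
    ((H.rep B hB).mem_sides _).2 ⟨((f A).1, d), mem_overlaps_iff.2 ⟨h.2.1.symm, Or.inr h.2.2⟩, rfl⟩⟩

theorem eq_of_isNext_left {A B C : Tile} (hB : B ∈ 𝒯) (hC : C ∈ 𝒯) {d : Dir}
    (h : IsNext d (f A) (f B)) (h' : IsNext d (f A) (f C)) : B = C :=
  H.eq_of_dn hB hC (h.2.2.symm.trans h'.2.2)

theorem eq_of_isNext_right {A B C : Tile} (hA : A ∈ 𝒯) (hB : B ∈ 𝒯) {d : Dir}
    (h : IsNext d (f A) (f C)) (h' : IsNext d (f B) (f C)) : A = B :=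
  H.eq_of_up hA hB (by rw [← up_dn (f A).1 d, h.2.2, ← h'.2.2, up_dn])

/-- Three tiles of a run, in the order of the ribbon. -/
def Chain (𝒯 : Finset Tile) (f : Tile → Loz) (d : Dir) (A B C : Tile) : Prop :=
  A ∈ 𝒯 ∧ B ∈ 𝒯 ∧ C ∈ 𝒯 ∧ IsNext d (f A) (f B) ∧ IsNext d (f B) (f C)

theorem not_chain_four {A B C D : Tile} {d : Dir} (h : Chain 𝒯 f d A B C) (hD : D ∈ 𝒯)
    (hCD : IsNext d (f C) (f D)) : False := by
  obtain ⟨hA, hB, hC, hAB, hBC⟩ := h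
  have l₁ := hAB.height_lt
  have l₂ := hBC.height_lt
  have l₃ := hCD.height_lt
  have hrun : IsRun 𝒯 (k := 3) ![A, B, C, D] := by
    refine ⟨?_, ?_, ![seg o w ((f A).1, d), seg o w ((f B).1, d), seg o w ((f C).1, d)], ?_, ?_⟩
    · have hmono : StrictMono (fun i => height d (f (![A, B, C, D] i))) := by
        rw [Fin.strictMono_iff_lt_succ]
        intro i
        fin_cases i
        exacts [l₁, l₂, l₃]
      exact fun i j hij => hmono.injective (congrArg (fun T => height d (f T)) hij)
    · intro i
      fin_cases i
      exacts [hA, hB, hC, hD]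
    · intro i
      fin_cases i
      exacts [H.seg_mem_sides hA hB hAB, H.seg_mem_sides hB hC hBC, H.seg_mem_sides hC hD hCD]
    · intro i j
      fin_cases i <;> fin_cases j <;> exact (parallelSides_seg H.ne_zero).2 rfl
  exact absurd (H.tredoku.run_le_three 3 _ hrun) (by norm_num)

/-- Predecessors and successors in a direction are unique, so two chains through `T` agree unless
they place `T` differently; then they combine into a run of four. -/
theorem chain_unique {A B C A' B' C' T : Tile} {d : Dir} (h : Chain 𝒯 f d A B C)
    (h' : Chain 𝒯 f d A' B' C') (hT : T = A ∨ T = B ∨ T = C) (hT' : T = A' ∨ T = B' ∨ T = C') :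
    A = A' ∧ B = B' ∧ C = C' := by
  have h₀ := h
  have h₀' := h'
  obtain ⟨hA, hB, hC, hAB, hBC⟩ := h
  obtain ⟨hA', hB', hC', hAB', hBC'⟩ := h'
  have left := fun {A B C : Tile} => H.eq_of_isNext_left (A := A) (B := B) (C := C) (d := d)
  have right := fun {A B C : Tile} => H.eq_of_isNext_right (A := A) (B := B) (C := C) (d := d)
  rcases hT with rfl | rfl | rfl <;> rcases hT' with rfl | rfl | rfl
  · obtain rfl := left hB hB' hAB hAB'
    exact ⟨rfl, rfl, left hC hC' hBC hBC'⟩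
  · obtain rfl := left hB hC' hAB hBC'
    exact (H.not_chain_four h₀' hC hBC).elim
  · exact (H.not_chain_four h₀' hB hAB).elim
  · obtain rfl := left hC hB' hBC hAB'
    exact (H.not_chain_four h₀ hC' hBC').elim
  · exact ⟨right hA hA' hAB hAB', rfl, left hC hC' hBC hBC'⟩
  · exact (H.not_chain_four h₀' hC hBC).elim
  · exact (H.not_chain_four h₀ hB' hAB').elim
  · exact (H.not_chain_four h₀ hC' hBC').elim
  · obtain rfl := right hB hB' hBC hBC'
    exact ⟨right hA hA' hAB hAB', rfl, rfl⟩

theorem exists_chain_of_isRun {T : Fin (2 + 1) → Tile} (hT : IsRun 𝒯 T) :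
    ∃ d A B C, Chain 𝒯 f d A B C ∧ Set.range T = {A, B, C} := by
  obtain ⟨hinj, hmem, p, hp, hpar⟩ := hT
  have h01 : T 0 ≠ T 1 := fun h => absurd (hinj h) (by decide)
  have h12 : T 1 ≠ T 2 := fun h => absurd (hinj h) (by decide)
  have h02 : T 0 ≠ T 2 := fun h => absurd (hinj h) (by decide)
  obtain ⟨e, he, hn⟩ := H.exists_isNext (hmem 0) (hmem 1) h01 (hp 0).1 (hp 0).2
  obtain ⟨e', he', hn'⟩ := H.exists_isNext (hmem 1) (hmem 2) h12 (hp 1).1 (hp 1).2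
  have hd : e.2 = e'.2 := (parallelSides_seg H.ne_zero).1 (he ▸ he' ▸ hpar 0 1)
  rw [← hd] at hn'
  have hrange : Set.range T = {T 0, T 1, T 2} := by
    ext x
    simp [Fin.exists_fin_succ, eq_comm]
  rcases hn with hn | hn <;> rcases hn' with hn' | hn'
  · exact ⟨e.2, T 0, T 1, T 2, ⟨hmem 0, hmem 1, hmem 2, hn, hn'⟩, hrange⟩
  · exact absurd (H.eq_of_isNext_right (hmem 0) (hmem 2) hn hn') h02
  · exact absurd (H.eq_of_isNext_left (hmem 0) (hmem 2) hn hn') h02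
  · refine ⟨e.2, T 2, T 1, T 0, ⟨hmem 2, hmem 1, hmem 0, hn', hn⟩, ?_⟩
    rw [hrange]
    ext x
    simp only [Set.mem_insert_iff, Set.mem_singleton_iff]
    tauto

/-- If there are two thirds as many runs as tiles, then each tile lies in runs of both directions. -/
theorem exists_chain (hcount : 3 * numRuns 𝒯 = 2 * 𝒯.card) {A : Tile} (hA : A ∈ 𝒯)
    {d : Dir} (hd : d ≠ (f A).2) :
    ∃ B C D, Chain 𝒯 f d B C D ∧ (A = B ∨ A = C ∨ A = D) := by
  let R : Set (Set Tile) := {R | ∃ T : Fin (2 + 1) → Tile, IsRun 𝒯 T ∧ Set.range T = R}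
  have hR : ∀ R : R, ∃ (d : Dir) (T : Fin 3 → Tile), Chain 𝒯 f d (T 0) (T 1) (T 2) ∧
      R.1 = {T 0, T 1, T 2} := by
    rintro ⟨_, T, hT, rfl⟩
    obtain ⟨d, A, B, C, h, h'⟩ := H.exists_chain_of_isRun hT
    exact ⟨d, ![A, B, C], h, h'⟩
  choose δ τ hτ hRτ using hR
  have mem : ∀ R i, τ R i ∈ 𝒯 := by
    intro R i
    fin_cases i
    exacts [(hτ R).1, (hτ R).2.1, (hτ R).2.2.1]
  have ne : ∀ R i, δ R ≠ (f (τ R i)).2 := by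
    intro R i
    fin_cases i
    exacts [(hτ R).2.2.2.1.1.symm, (hτ R).2.2.2.1.2.1.symm, (hτ R).2.2.2.2.2.1.symm]
  have mem3 : ∀ (R : R) (i : Fin 3), τ R i = τ R 0 ∨ τ R i = τ R 1 ∨ τ R i = τ R 2 := by
    intro R i
    fin_cases i <;> simp
  -- The double count: 3 places in each run against 2 directions at each tile. Injectivity is the
  -- uniqueness of chains, and equal cardinalities make the map onto.
  let Φ : R × Fin 3 → Σ A : 𝒯, {d : Dir // d ≠ (f A).2} :=
    fun x => ⟨⟨τ x.1 x.2, mem x.1 x.2⟩, δ x.1, ne x.1 x.2⟩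
  have hΦ : ∀ x y, Φ x = Φ y → τ x.1 x.2 = τ y.1 y.2 ∧ δ x.1 = δ y.1 := by
    intro x y h
    have h₁ : τ x.1 x.2 = τ y.1 y.2 := congrArg (fun z => z.1.1) h
    exact ⟨h₁, congrArg (fun z => z.2.1) h⟩
  have inj : Function.Injective Φ := by
    rintro ⟨R, i⟩ ⟨R', j⟩ h
    obtain ⟨h₁, h₂⟩ := hΦ _ _ h
    simp only at h₁ h₂
    obtain ⟨e₀, e₁, e₂⟩ := H.chain_unique (hτ R) (h₂ ▸ hτ R') (mem3 R i) (h₁ ▸ mem3 R' j)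
    obtain rfl : R = R' := Subtype.ext (by rw [hRτ R, hRτ R', e₀, e₁, e₂])
    have hmono : StrictMono (fun i => height (δ R) (f (τ R i))) := by
      rw [Fin.strictMono_iff_lt_succ]
      intro i
      fin_cases i
      exacts [(hτ R).2.2.2.1.height_lt, (hτ R).2.2.2.2.height_lt]
    rw [hmono.injective (congrArg (fun T => height (δ R) (f T)) h₁)]
  have two : ∀ k : Dir, Fintype.card {d : Dir // d ≠ k} = 2 := by
    intro k
    rw [Fintype.card_subtype_compl, Fintype.card_subtype_eq]
    rfl
  have hbij : Function.Bijective Φ := by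
    refine inj.bijective_of_nat_card_le ?_
    rw [Nat.card_eq_fintype_card, Fintype.card_sigma, Nat.card_prod, Nat.card_fin]
    simp only [two, Finset.sum_const, Finset.card_univ, Fintype.card_coe, smul_eq_mul]
    have : Nat.card R = numRuns 𝒯 := rfl
    omega
  obtain ⟨⟨R, i⟩, h⟩ := hbij.2 ⟨⟨A, hA⟩, d, hd⟩
  have h₁ : τ R i = A := congrArg (fun z => z.1.1) h
  have h₂ : δ R = d := congrArg (fun z => z.2.1) h
  exact ⟨_, _, _, h₂ ▸ hτ R, h₁ ▸ mem3 R i⟩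

theorem bounded {A B : 𝒯} (p : (dualGraph 𝒯).Walk A B) :
    |(f A).1.1 - (f B).1.1| ≤ (p.length : ℤ) := by
  induction p with
  | nil => simp
  | @cons A B C hadj p ih =>
    have hadj' := hadj
    obtain ⟨hne, s, hs, hs'⟩ := hadj'
    obtain ⟨e, -, h⟩ := H.exists_isNext A.2 B.2 (fun h => hne (Subtype.ext h)) hs hs'
    have h₁ : |(f A).1.1 - (f B).1.1| ≤ 1 := by
      rcases h with h | h
      · rw [abs_sub_comm]
        exact abs_next_sub_le h
      · exact abs_next_sub_le h
    rw [SimpleGraph.Walk.length_cons]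
    push_cast
    rw [abs_le] at *
    omega

theorem saturated (hcard : 𝒯.card = 12) (hruns : numRuns 𝒯 = 8) : Saturated (𝒯.image f) := by
  have hmem : ∀ {A}, A ∈ 𝒯 → (f A ∈ 𝒯.image f) := fun hA => Finset.mem_image_of_mem f hA
  refine ⟨?_, ?_, ?_, ?_, ?_, ?_⟩
  · simp only [Finset.forall_mem_image]
    exact fun A hA B hB h => congrArg f (H.eq_of_up hA hB h)
  · simp only [Finset.forall_mem_image]
    exact fun A hA B hB h => congrArg f (H.eq_of_dn hA hB h)
  · simp only [Finset.forall_mem_image]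
    intro A hA d hd
    obtain ⟨B, C, D, h, hA'⟩ := H.exists_chain (by rw [hcard, hruns]) hA hd
    refine ⟨f B, hmem h.1, f C, hmem h.2.1, f D, hmem h.2.2.1, h.2.2.2.1, h.2.2.2.2, ?_, ?_, ?_⟩
    · exact hA'.imp (congrArg f) (Or.imp (congrArg f) (congrArg f))
    -- A tile before the first one or after the last one would give a run of four.
    · intro e he
      obtain ⟨E, hE, hEf⟩ := Finset.mem_image.1 he
      have hn := isNext_prev h.2.2.2.1.1 e
      rw [← hEf] at hn
      exact H.not_chain_four ⟨hE, h.1, h.2.1, hn, h.2.2.2.1⟩ h.2.2.1 h.2.2.2.2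
    · intro e he
      obtain ⟨E, hE, hEf⟩ := Finset.mem_image.1 he
      have hn := isNext_next h.2.2.2.2.2.1 e
      rw [← hEf] at hn
      exact H.not_chain_four h hE hn
  · intro P hP hne hcl
    refine Finset.Subset.antisymm hP ?_
    obtain ⟨t, ht⟩ := hne
    obtain ⟨A, hA, rfl⟩ := Finset.mem_image.1 (hP ht)
    intro t' ht'
    obtain ⟨B, hB, rfl⟩ := Finset.mem_image.1 ht'
    have hr := (SimpleGraph.reachable_iff_reflTransGen _ _).1
      (H.tredoku.connected.preconnected ⟨A, hA⟩ ⟨B, hB⟩)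
    suffices ∀ C : 𝒯, Relation.ReflTransGen (dualGraph 𝒯).Adj ⟨A, hA⟩ C → f C ∈ P from this _ hr
    intro C hC
    induction hC with
    | refl => exact ht
    | @tail C D _ hadj ih =>
      obtain ⟨hne, s, hs, hs'⟩ := hadj
      obtain ⟨e, -, h | h⟩ := H.exists_isNext C.2 D.2 (fun h => hne (Subtype.ext h)) hs hs'
      · obtain ⟨i, hi⟩ := h.exists_next
        rw [hi]
        exact (hcl _ ih _ h.1.symm i).1 (hi ▸ hmem D.2)
      · obtain ⟨i, hi⟩ := h.exists_prev
        rw [hi]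
        exact (hcl _ ih _ h.2.1.symm i).2 (hi ▸ hmem D.2)
  · rw [Finset.card_image_of_injOn (fun A hA B hB h => H.injOn hA hB h), hcard]
  · simp only [Finset.forall_mem_image]
    intro A hA B hB
    -- A path through at most twelve tiles has at most 11 edges, each of which changes the first
    -- coordinate by at most 1.
    obtain ⟨p, hp⟩ := (H.tredoku.connected.preconnected ⟨A, hA⟩ ⟨B, hB⟩).exists_isPath
    have h₁ := H.bounded p
    have h₂ := hp.length_lt
    rw [Fintype.card_coe, hcard] at h₂
    exact h₁.trans (by omega)

end Placed

end Tredoku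

theorem mainTheorem2 :
    ¬ ∃ 𝒯 : Finset Tredoku.Tile,
      Tredoku.IsTredoku 𝒯 ∧ 𝒯.card = 12 ∧ Tredoku.numRuns 𝒯 = 8 := by
  rintro ⟨𝒯, h, hcard, hruns⟩
  obtain ⟨o, w, f, H⟩ := h.exists_placed
  exact Tredoku.Loz.not_saturated _ (H.saturated hcard hruns)
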